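/- Let $n\ge m\ge 1$ and $l\ge 1$. Let $A\in\mathbb R^{n\times n}$ be symmetric positive definite (SPD), let $B\in\mathbb R^{m\times n}$ have full row rank $m$, let $D\in\mathbb R^{l\times l}$ be symmetric positive semidefinite, and let $C\in\mathbb R^{l\times m}$, where $C$ has full row rank $l$ if $D$ is not SPD. Let $M_A\in\mathbb R^{n\times n}$, $\widehat S\in\mathbb R^{m\times m}$, $\widehat M_S\in\mathbb R^{l\times l}$ be SPD, and let $W_S\in\{0,\widehat S^{-1}\}$ and $Y_A,Z_A\in\{0,M_A^{-1}\}$. Put $S=BA^{-1}B^T$, $$K=\begin{pmatrix}A&B^T&0\\B&0&C^T\\0&C&D\end{pmatrix},\qquad M=\begin{pmatrix}I&0&0\\BY_A&I&0\\0&-CW_S&I\end{pmatrix} \begin{pmatrix}M_A&0&0\\0&-\widehat S&0\\0&0&\widehat M_S\end{pmatrix} \begin{pmatrix}I&Z_AB^T&0\\0&I&-W_SC^T\\0&0&I\end{pmatrix}.$$ For a real matrix $T$ with only real eigenvalues, write $\lambda_{\min}(T)$ and $\lambda_{\max}(T)$ for its smallest and largest eigenvalue. Let $(\underline\mu,\bar\mu)$,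 $(\underline\nu,\bar\nu)$, $(\underline\omega,\bar\omega)$, $(\underline\tau,\bar\tau)$, $(\underline\varphi,\bar\varphi)$, $(\underline\phi,\bar\phi)$, $(\underline\kappa,\bar\kappa)$, $(\underline\gamma,\bar\gamma)$ be the pairs $(\lambda_{\min},\lambda_{\max})$ of the matrices $$M_A^{-1}A,\quad \widehat S^{-1}S,\quad \widehat M_S^{-1}C\widehat S^{-1}C^T,\quad \widehat M_S^{-1}D,\quad W_SS,\quad \widehat M_S^{-1}CW_SC^T,\quad \widehat M_S^{-1}(D+CW_SC^T),\quad Y_AA+Z_AA-Y_AAZ_AA,$$ respectively (all of these have only real eigenvalues). Define $$g_1(s)=1+\tfrac s2-\sqrt{\tfrac{s^2}4+s},\quad g_2(s)=1+\tfrac s2+\sqrt{\tfrac{s^2}4+s}\quad(s\ge 0),\qquad \varrho(s,t)=\max\{(s-1)^2,(1-t)^2\},$$ $$\underline h(t)=\begin{cases}\underline\kappa,&0\le t\le 1,\\ \underline\tau+\underline\phi,&1<t\le 2,\end{cases}\qquad \bar h(t)=\begin{cases}\bar\kappa,&0\le t\le 1,\\ \bar\tau+\bar\phi,&1<t\le 2,\end{cases}\qquad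 \widehat\xi=\frac{\bar\phi\,\bar\varphi\,(1-\underline\gamma)}{\underline\mu},\qquad \xi_1=\bar\nu-\frac{\bar\nu}{\bar\mu}.$$ Assume $0<\bar\mu\le 2$, $0<\bar\nu\le 2$ and $0<\bar\mu\bar\nu<2$. Then every eigenvalue $\lambda\in\mathbb C$ of $M^{-1}K$ satisfies $$\underline\eta\le \operatorname{Re}\lambda\le\bar\eta,\qquad |\operatorname{Im}\lambda|\le\rho,$$ where $\underline\eta,\bar\eta,\rho$ (with $\rho\ge 0$) are given as follows. (1) If $\bar\gamma\le 1$: $$\underline\eta=\min\Big\{\underline\mu,\ \underline h(\bar\varphi)+\underline\phi(1-\bar\varphi),\ \frac{\underline\gamma\,\underline\nu}{g_1(\widehat\xi)}\Big\}g_1(\widehat\xi),\qquad \bar\eta=\max\Big\{\bar\mu,\ \bar h(\bar\varphi)+\bar\phi(1-\underline\varphi),\ \frac{\bar\gamma\,\bar\nu}{g_2(\widehat\xi)}\Big\}g_2(\widehat\xi),$$ $$\rho^2=\bar\omega-\bar\phi+\bar\phi\,\varrho(\bar\gamma\bar\varphi,\underline\gamma\,\underline\varphi)+\bar\nu\,\lambda_{\max}\big((I-Y_AA)(I-Z_AA)M_A^{-1}A\big).$$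 (2) If $\underline\gamma\ge 1$: $$\underline\eta=\min\big\{\underline\mu\, g_1(\xi_1),\ \underline\nu\, g_1(\xi_1),\ \underline h(\bar\mu\bar\varphi)+\underline\phi(1-\bar\mu\bar\varphi)\big\},\qquad \bar\eta=\max\big\{\bar\mu\, g_2(\xi_1),\ \bar\nu\, g_2(\xi_1),\ \bar h(\bar\mu\bar\varphi)+\bar\phi(1-\underline\mu\,\underline\varphi)\big\},$$ $$\rho^2=\bar\omega-\bar\phi+\bar\phi\big((\bar\mu-1)\bar\mu\bar\varphi+\varrho(\bar\mu\bar\varphi,\underline\mu\,\underline\varphi)\big).$$ (3) If $\underline\gamma<1<\bar\gamma$: $$\underline\eta=\min\Big\{\underline\mu,\ \underline h(\bar\mu\bar\varphi)+\underline\phi(1-\bar\mu\bar\varphi),\ \frac{g_1(\xi_1)}{g_1(\widehat\xi)},\ \frac{\underline\mu\,\underline\nu\, g_1(\xi_1)}{g_1(\widehat\xi)}\Big\}g_1(\widehat\xi),$$ $$\bar\eta=\max\Big\{1,\ \bar h(\bar\mu\bar\varphi)+\bar\phi(1-\underline\varphi),\ \frac{\bar\mu\, g_2(\xi_1)}{g_2(\widehat\xi)},\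 \frac{\bar\nu\, g_2(\xi_1)}{g_2(\widehat\xi)}\Big\}g_2(\widehat\xi),$$ $$\rho^2=\bar\omega-\bar\phi+\bar\phi\big((\bar\mu-1)\bar\mu\bar\varphi+\varrho(\bar\mu\bar\varphi,\underline\mu\,\underline\varphi)\big)+\bar\nu\,\lambda_{\max}\big(M_A^{-1}A(I-M_A^{-1}A)\big).$$ (If $\underline\gamma=\bar\gamma=1$, both (1) and (2) apply and both sets of bounds hold.) -/

import Mathlib

open Matrix

noncomputable section

namespace InexactBlock

/-- The set of eigenvalues of a square matrix over a field. -/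
def eigs {ι 𝕜 : Type*} [Fintype ι] [DecidableEq ι] [Field 𝕜] (T : Matrix ι ι 𝕜) : Set 𝕜 :=
  {x | Module.End.HasEigenvalue (Matrix.toLin' T) x}

/-- Smallest eigenvalue of a real matrix. It is only applied to matrices of positive order all of
whose eigenvalues are real, so that the infimum runs over a finite non-empty set and is a
minimum. -/
def lamMin {ι : Type*} [Fintype ι] [DecidableEq ι] (T : Matrix ι ι ℝ) : ℝ := sInf (eigs T)

/-- Largest eigenvalue of a real matrix (see `lamMin`). -/
def lamMax {ι : Type*} [Fintype ι] [DecidableEq ι] (T : Matrix ι ι ℝ) : ℝ := sSup (eigs T)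

/-- The matrix with three-by-three block structure and the given blocks, row by row. -/
def block3 {n m l : ℕ}
    (T₁₁ : Matrix (Fin n) (Fin n) ℝ) (T₁₂ : Matrix (Fin n) (Fin m) ℝ)
    (T₁₃ : Matrix (Fin n) (Fin l) ℝ)
    (T₂₁ : Matrix (Fin m) (Fin n) ℝ) (T₂₂ : Matrix (Fin m) (Fin m) ℝ)
    (T₂₃ : Matrix (Fin m) (Fin l) ℝ)
    (T₃₁ : Matrix (Fin l) (Fin n) ℝ) (T₃₂ : Matrix (Fin l) (Fin m) ℝ)
    (T₃₃ : Matrix (Fin l) (Fin l) ℝ) :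
    Matrix (Fin n ⊕ (Fin m ⊕ Fin l)) (Fin n ⊕ (Fin m ⊕ Fin l)) ℝ :=
  fromBlocks T₁₁ (fromCols T₁₂ T₁₃) (fromRows T₂₁ T₃₁) (fromBlocks T₂₂ T₂₃ T₃₂ T₃₃)

/-- The matrices from which the coefficient matrix and the preconditioner are built
(no assumption on them is made here). -/
structure Data (n m l : ℕ) where
  A : Matrix (Fin n) (Fin n) ℝ
  B : Matrix (Fin m) (Fin n) ℝ
  C : Matrix (Fin l) (Fin m) ℝ
  D : Matrix (Fin l) (Fin l) ℝ
  /-- the approximation of `A` -/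
  MA : Matrix (Fin n) (Fin n) ℝ
  /-- the approximation `Ŝ` of the Schur complement `S` -/
  Sh : Matrix (Fin m) (Fin m) ℝ
  /-- the approximation of `D + C S⁻¹ Cᵀ` -/
  MSh : Matrix (Fin l) (Fin l) ℝ
  WS : Matrix (Fin m) (Fin m) ℝ
  YA : Matrix (Fin n) (Fin n) ℝ
  ZA : Matrix (Fin n) (Fin n) ℝ

namespace Data

variable {n m l : ℕ} (P : Data n m l)

/-- The coefficient matrix. -/
def K : Matrix (Fin n ⊕ (Fin m ⊕ Fin l)) (Fin n ⊕ (Fin m ⊕ Fin l)) ℝ :=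
  block3
    P.A  P.Bᵀ 0
    P.B  0    P.Cᵀ
    0    P.C  P.D

/-- The general inexact block factorization preconditioner. -/
def M : Matrix (Fin n ⊕ (Fin m ⊕ Fin l)) (Fin n ⊕ (Fin m ⊕ Fin l)) ℝ :=
  block3
      1             0                0
      (P.B * P.YA)  1                0
      0             (-(P.C * P.WS))  1
  * block3
      P.MA  0        0
      0     (-P.Sh)  0
      0     0        P.MSh
  * block3
      1  (P.ZA * P.Bᵀ)  0
      0  1              (-(P.WS * P.Cᵀ))
      0  0              1

/-- The Schur complement `S = B A⁻¹ Bᵀ`. -/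
def S : Matrix (Fin m) (Fin m) ℝ := P.B * P.A⁻¹ * P.Bᵀ

def muMin : ℝ := lamMin (P.MA⁻¹ * P.A)
def muMax : ℝ := lamMax (P.MA⁻¹ * P.A)
def nuMin : ℝ := lamMin (P.Sh⁻¹ * P.S)
def nuMax : ℝ := lamMax (P.Sh⁻¹ * P.S)
def omegaMax : ℝ := lamMax (P.MSh⁻¹ * P.C * P.Sh⁻¹ * P.Cᵀ)
def tauMin : ℝ := lamMin (P.MSh⁻¹ * P.D)
def tauMax : ℝ := lamMax (P.MSh⁻¹ * P.D)
def varphiMin : ℝ := lamMin (P.WS * P.S)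
def varphiMax : ℝ := lamMax (P.WS * P.S)
def phiMin : ℝ := lamMin (P.MSh⁻¹ * P.C * P.WS * P.Cᵀ)
def phiMax : ℝ := lamMax (P.MSh⁻¹ * P.C * P.WS * P.Cᵀ)
def kappaMin : ℝ := lamMin (P.MSh⁻¹ * (P.D + P.C * P.WS * P.Cᵀ))
def kappaMax : ℝ := lamMax (P.MSh⁻¹ * (P.D + P.C * P.WS * P.Cᵀ))
def gammaMin : ℝ := lamMin (P.YA * P.A + P.ZA * P.A - P.YA * P.A * P.ZA * P.A)
def gammaMax : ℝ := lamMax (P.YA * P.A + P.ZA * P.A - P.YA * P.A * P.ZA * P.A)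

/-- Used for `0 ≤ t ≤ 2` only. -/
def hMin (t : ℝ) : ℝ := if t ≤ 1 then P.kappaMin else P.tauMin + P.phiMin

/-- Used for `0 ≤ t ≤ 2` only. -/
def hMax (t : ℝ) : ℝ := if t ≤ 1 then P.kappaMax else P.tauMax + P.phiMax

/-- `ξ̂` -/
def xiHat : ℝ := P.phiMax * P.varphiMax * (1 - P.gammaMin) / P.muMin

/-- `ξ₁` -/
def xiOne : ℝ := P.nuMax - P.nuMax / P.muMax

end Data

def g₁ (s : ℝ) : ℝ := 1 + 1 / 2 * s - √(1 / 4 * s ^ 2 + s)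

def g₂ (s : ℝ) : ℝ := 1 + 1 / 2 * s + √(1 / 4 * s ^ 2 + s)

/-- `ϱ(s, t)` -/
def varrho (s t : ℝ) : ℝ := max ((s - 1) ^ 2) ((1 - t) ^ 2)

namespace Data

variable {n m l : ℕ} (P : Data n m l)

/-! The bounds for the case `γ̄ ≤ 1`. -/

def etaMin₁ : ℝ :=
  min P.muMin (min (P.hMin P.varphiMax + P.phiMin * (1 - P.varphiMax))
    (P.gammaMin * P.nuMin / g₁ P.xiHat)) * g₁ P.xiHat

def etaMax₁ : ℝ :=
  max P.muMax (max (P.hMax P.varphiMax + P.phiMax * (1 - P.varphiMin))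
    (P.gammaMax * P.nuMax / g₂ P.xiHat)) * g₂ P.xiHat

def rho₁ : ℝ :=
  √(P.omegaMax - P.phiMax
    + P.phiMax * varrho (P.gammaMax * P.varphiMax) (P.gammaMin * P.varphiMin)
    + P.nuMax * lamMax ((1 - P.YA * P.A) * (1 - P.ZA * P.A) * P.MA⁻¹ * P.A))

/-! The bounds for the case `1 ≤ γ̲`. -/

def etaMin₂ : ℝ :=
  min (P.muMin * g₁ P.xiOne) (min (P.nuMin * g₁ P.xiOne)
    (P.hMin (P.muMax * P.varphiMax) + P.phiMin * (1 - P.muMax * P.varphiMax)))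

def etaMax₂ : ℝ :=
  max (P.muMax * g₂ P.xiOne) (max (P.nuMax * g₂ P.xiOne)
    (P.hMax (P.muMax * P.varphiMax) + P.phiMax * (1 - P.muMin * P.varphiMin)))

def rho₂ : ℝ :=
  √(P.omegaMax - P.phiMax
    + P.phiMax * ((P.muMax - 1) * P.muMax * P.varphiMax
      + varrho (P.muMax * P.varphiMax) (P.muMin * P.varphiMin)))

/-! The bounds for the case `γ̲ < 1 < γ̄`. -/

def etaMin₃ : ℝ :=
  min P.muMin (min (P.hMin (P.muMax * P.varphiMax) + P.phiMin * (1 - P.muMax * P.varphiMax))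
    (min (g₁ P.xiOne / g₁ P.xiHat)
      (P.muMin * P.nuMin * g₁ P.xiOne / g₁ P.xiHat))) * g₁ P.xiHat

def etaMax₃ : ℝ :=
  max 1 (max (P.hMax (P.muMax * P.varphiMax) + P.phiMax * (1 - P.varphiMin))
    (max (P.muMax * g₂ P.xiOne / g₂ P.xiHat)
      (P.nuMax * g₂ P.xiOne / g₂ P.xiHat))) * g₂ P.xiHat

def rho₃ : ℝ :=
  √(P.omegaMax - P.phiMax
    + P.phiMax * ((P.muMax - 1) * P.muMax * P.varphiMax
      + varrho (P.muMax * P.varphiMax) (P.muMin * P.varphiMin))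
    + P.nuMax * lamMax (P.MA⁻¹ * P.A * (1 - P.MA⁻¹ * P.A)))

end Data

end InexactBlock

end

/-!
The eigenvalues are located by a Rayleigh quotient of a well-chosen similar matrix.

Coordinates can be changed so that `M_A`, `Ŝ`, `M̂_S` become identities and `A` becomes
`diag(a)` (`exists_congr_diagonal`, `Data.det_congr`); all extreme eigenvalues in the bounds are
invariant under this change (`Data.enclosed_of_congr`). The matrix `W_S` becomes a scalar
`s ∈ {0, 1}`, and `Y_A`, `Z_A` become scalars `η, ζ ∈ {0, 1}`. Transposing `M` exchanges `Y_A` and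
`Z_A`, so that `Y_A = 0`, `Z_A = M_A⁻¹` need not be considered (`Normalized.det_swap`).

If `U` is the upper triangular factor of `M` and `(x, y, z)` is `U` times an eigenvector, then
`(x, y, z)` is an eigenvector of a matrix whose `x`-`y` blocks are `(1 - ζa)Bᵀ` and `-B(1 - ηa)`
(`Normalized.exists_equations`). A diagonal scaling of `x` makes them transposes of each other up
to sign: the sign is `-1` at the indices where `(1 - ηa)(1 - ζa) ≥ 0` and `+1` at the others. The
three cases of the theorem are those where all, none, or only some indices are of the first kind.
The scaling may be singular; the eigenvectors it annihilates belong to the eigenvalue `1`, which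
is then an eigenvalue of `M_A⁻¹A` and lies in the interval.

In the scaled coordinates the symmetric part is the direct sum of a form in `z` and the `x_i` of
the first kind, and a form in `y` and the remaining `x_i` (`ReducedEigen.re_energy`). A block
`LDLᵀ` factorization of each gives the bounds for the real part: the pivots are `a` and a Schur
complement, and the eigenvalues of `LLᵀ` lie between `g₁ ξ` and `g₂ ξ` when the squared norm of
the off-diagonal block of `L` is at most `ξ` (`g₁_mul_le_and_le_g₂_mul`,
`ReducedEigen.re_bounds`). The skew part couples only `z` and the `x_i` of the first kind with `y`
and the other `x_i`, and the norm of this coupling bounds the imaginary part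
(`ReducedEigen.im_energy`, `ReducedEigen.abs_im_le`).
-/

noncomputable section

namespace InexactBlock

/-! ### Eigenvalues and quadratic forms of real matrices -/

section

theorem eigs_eq_spectrum {ι 𝕜 : Type*} [Fintype ι] [DecidableEq ι] [Field 𝕜] (T : Matrix ι ι 𝕜) :
    eigs T = spectrum 𝕜 T := by
  ext x
  rw [eigs, Set.mem_ofPred_eq, Module.End.hasEigenvalue_iff_mem_spectrum, Matrix.spectrum_toLin']

theorem eigs_conj {ι 𝕜 : Type*} [Fintype ι] [DecidableEq ι] [Field 𝕜] {R R' : Matrix ι ι 𝕜}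
    (h : R * R' = 1) (T : Matrix ι ι 𝕜) : eigs (R' * T * R) = eigs T := by
  rw [eigs_eq_spectrum, eigs_eq_spectrum]
  exact spectrum.units_conjugate (a := T) (u := ⟨R', R, mul_eq_one_comm.mp h, h⟩)

variable {ι : Type*} [Fintype ι]

/-- The value at a complex vector `y` of the Hermitian form of a real symmetric matrix `H`,
written through the real and the imaginary part of `y`. -/
def qf (H : Matrix ι ι ℝ) (y : ι → ℂ) : ℝ :=
  (fun j => (y j).re) ⬝ᵥ H *ᵥ (fun j => (y j).re) +
    (fun j => (y j).im) ⬝ᵥ H *ᵥ (fun j => (y j).im)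

theorem qf_nonneg {H : Matrix ι ι ℝ} (hH : H.PosSemidef) (y : ι → ℂ) : 0 ≤ qf H y := by
  have h1 := hH.dotProduct_mulVec_nonneg (fun j => (y j).re)
  have h2 := hH.dotProduct_mulVec_nonneg (fun j => (y j).im)
  simp only [star_trivial] at h1 h2
  exact add_nonneg h1 h2

theorem qf_add (H H' : Matrix ι ι ℝ) (y : ι → ℂ) : qf (H + H') y = qf H y + qf H' y := by
  simp only [qf, add_mulVec, dotProduct_add]
  ring

theorem qf_sub (H H' : Matrix ι ι ℝ) (y : ι → ℂ) : qf (H - H') y = qf H y - qf H' y := by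
  simp only [qf, sub_mulVec, dotProduct_sub]
  ring

theorem qf_smul (c : ℝ) (H : Matrix ι ι ℝ) (y : ι → ℂ) : qf (c • H) y = c * qf H y := by
  simp only [qf, smul_mulVec, dotProduct_smul, smul_eq_mul]
  ring

/-- `XᵀHX` at `y` is `H` at `Xy`. -/
theorem qf_congr {κ : Type*} [Fintype κ] (X : Matrix κ ι ℝ) (H : Matrix κ κ ℝ) (y : ι → ℂ) :
    qf (Xᵀ * H * X) y = qf H (X.map (fun r : ℝ => (r : ℂ)) *ᵥ y) := by
  have hre : (fun j => ((X.map (fun r : ℝ => (r : ℂ)) *ᵥ y) j).re) = X *ᵥ fun j => (y j).re := by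
    ext j
    simp [mulVec, dotProduct]
  have him : (fun j => ((X.map (fun r : ℝ => (r : ℂ)) *ᵥ y) j).im) = X *ᵥ fun j => (y j).im := by
    ext j
    simp [mulVec, dotProduct]
  unfold qf
  rw [hre, him]
  simp only [← mulVec_mulVec, dotProduct_mulVec _ Xᵀ, vecMul_transpose]

variable [DecidableEq ι]

theorem eigs_finite (T : Matrix ι ι ℝ) : (eigs T).Finite :=
  Module.End.finite_hasEigenvalue _

theorem lamMin_le {T : Matrix ι ι ℝ} {x : ℝ} (hx : x ∈ eigs T) : lamMin T ≤ x :=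
  csInf_le (eigs_finite T).bddBelow hx

theorem le_lamMax {T : Matrix ι ι ℝ} {x : ℝ} (hx : x ∈ eigs T) : x ≤ lamMax T :=
  le_csSup (eigs_finite T).bddAbove hx

theorem mem_eigs_diagonal (d : ι → ℝ) (i : ι) : d i ∈ eigs (diagonal d) := by
  rw [eigs_eq_spectrum, spectrum_diagonal]
  exact ⟨i, rfl⟩

theorem eigs_nonempty [Nonempty ι] {H : Matrix ι ι ℝ} (hH : H.IsHermitian) : (eigs H).Nonempty := by
  rw [eigs_eq_spectrum, hH.spectrum_real_eq_range_eigenvalues]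
  exact Set.range_nonempty _

theorem posSemidef_sub_lamMin {H : Matrix ι ι ℝ} (hH : H.IsHermitian) :
    (H - algebraMap ℝ _ (lamMin H)).PosSemidef := by
  have h1 : (algebraMap ℝ (Matrix ι ι ℝ) (lamMin H)).IsHermitian := by
    rw [algebraMap_eq_diagonal]
    exact isHermitian_diagonal _
  rw [posSemidef_iff_isHermitian_and_spectrum_nonneg]
  refine ⟨hH.sub h1, ?_⟩
  rw [← spectrum.sub_singleton_eq, ← eigs_eq_spectrum]
  rintro _ ⟨x, hx, _, rfl, rfl⟩
  exact sub_nonneg.mpr (lamMin_le hx)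

theorem posSemidef_lamMax_sub {H : Matrix ι ι ℝ} (hH : H.IsHermitian) :
    (algebraMap ℝ _ (lamMax H) - H).PosSemidef := by
  have h1 : (algebraMap ℝ (Matrix ι ι ℝ) (lamMax H)).IsHermitian := by
    rw [algebraMap_eq_diagonal]
    exact isHermitian_diagonal _
  rw [posSemidef_iff_isHermitian_and_spectrum_nonneg]
  refine ⟨h1.sub hH, ?_⟩
  rw [← spectrum.singleton_sub_eq, ← eigs_eq_spectrum]
  rintro _ ⟨_, rfl, x, hx, rfl⟩
  exact sub_nonneg.mpr (le_lamMax hx)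

theorem qf_diagonal (d : ι → ℝ) (y : ι → ℂ) : 
    qf (diagonal d) y = ∑ i, d i * Complex.normSq (y i) := by
  simp only [qf, dotProduct, mulVec_diagonal, ← Finset.sum_add_distrib, Complex.normSq_apply]
  exact Finset.sum_congr rfl fun i _ => by ring

theorem qf_algebraMap (c : ℝ) (y : ι → ℂ) :
    qf (algebraMap ℝ _ c) y = c * ∑ i, Complex.normSq (y i) := by
  rw [algebraMap_eq_diagonal, qf_diagonal, Finset.mul_sum]
  rfl

theorem lamMin_mul_le_qf {H : Matrix ι ι ℝ} (hH : H.IsHermitian) (y : ι → ℂ) :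
    lamMin H * ∑ i, Complex.normSq (y i) ≤ qf H y := by
  have := qf_nonneg (posSemidef_sub_lamMin hH) y
  rw [qf_sub, qf_algebraMap] at this
  linarith

theorem qf_le_lamMax_mul {H : Matrix ι ι ℝ} (hH : H.IsHermitian) (y : ι → ℂ) :
    qf H y ≤ lamMax H * ∑ i, Complex.normSq (y i) := by
  have := qf_nonneg (posSemidef_lamMax_sub hH) y
  rw [qf_sub, qf_algebraMap] at this
  linarith

theorem lamMin_nonneg [Nonempty ι] {H : Matrix ι ι ℝ} (hH : H.PosSemidef) : 0 ≤ lamMin H := by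
  refine le_csInf (eigs_nonempty hH.1) fun x hx => ?_
  rw [eigs_eq_spectrum] at hx
  exact (posSemidef_iff_isHermitian_and_spectrum_nonneg.mp hH).2 hx

theorem lamMin_le_lamMax [Nonempty ι] {H : Matrix ι ι ℝ} (hH : H.IsHermitian) :
    lamMin H ≤ lamMax H := by
  obtain ⟨x, hx⟩ := eigs_nonempty hH
  exact (lamMin_le hx).trans (le_lamMax hx)

theorem lamMin_mem [Nonempty ι] {H : Matrix ι ι ℝ} (hH : H.IsHermitian) : lamMin H ∈ eigs H :=
  (eigs_nonempty hH).csInf_mem (eigs_finite H)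

theorem lamMax_mem [Nonempty ι] {H : Matrix ι ι ℝ} (hH : H.IsHermitian) : lamMax H ∈ eigs H :=
  (eigs_nonempty hH).csSup_mem (eigs_finite H)

theorem eigs_diagonal (d : ι → ℝ) : eigs (diagonal d) = Set.range d := by
  rw [eigs_eq_spectrum, spectrum_diagonal]

end

/-! ### The functions `g₁` and `g₂`, and scalar inequalities -/

theorem g₁_add_g₂ (s : ℝ) : g₁ s + g₂ s = 2 + s := by
  unfold g₁ g₂
  ring

theorem g₁_mul_g₂ {s : ℝ} (hs : 0 ≤ s) : g₁ s * g₂ s = 1 := by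
  have := Real.mul_self_sqrt (show 0 ≤ 1 / 4 * s ^ 2 + s by positivity)
  unfold g₁ g₂
  linear_combination -this

theorem one_le_g₂ {s : ℝ} (hs : 0 ≤ s) : 1 ≤ g₂ s := by
  unfold g₂
  have := Real.sqrt_nonneg (1 / 4 * s ^ 2 + s)
  linarith

theorem g₁_pos {s : ℝ} (hs : 0 ≤ s) : 0 < g₁ s := by
  have h1 := g₁_mul_g₂ hs
  have h2 := one_le_g₂ hs
  by_contra! h
  nlinarith

theorem g₁_le_one {s : ℝ} (hs : 0 ≤ s) : g₁ s ≤ 1 := by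
  have h1 := g₁_mul_g₂ hs
  have h2 := one_le_g₂ hs
  have h3 := g₁_pos hs
  nlinarith

theorem one_sub_g₁_sq {s : ℝ} (hs : 0 ≤ s) : (1 - g₁ s) ^ 2 = s * g₁ s := by
  linear_combination g₁ s * g₁_add_g₂ s - g₁_mul_g₂ hs

theorem g₂_sub_one_sq {s : ℝ} (hs : 0 ≤ s) : (g₂ s - 1) ^ 2 = s * g₂ s := by
  linear_combination g₂ s * g₁_add_g₂ s - g₁_mul_g₂ hs

/-- `g₁ ξ` and `g₂ ξ` bound the extreme eigenvalues of `LLᵀ` for a unit lower triangular block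
matrix `L` whose off-diagonal block has squared norm at most `ξ`. Here `X`, `U` are the squared
norms of two vectors `x`, `u` and `r` is the real part of their inner product. -/
theorem g₁_mul_le_and_le_g₂_mul {ξ X U Z r : ℝ} (hξ : 0 ≤ ξ) (hX : 0 ≤ X) (hU : U ≤ ξ * Z)
    (h : ∀ t : ℝ, 0 ≤ t ^ 2 * X + 2 * t * r + U) :
    g₁ ξ * (X + Z) ≤ X + 2 * r + U + Z ∧ X + 2 * r + U + Z ≤ g₂ ξ * (X + Z) := by
  have hU0 : 0 ≤ U := by simpa using h 0
  rcases hξ.eq_or_lt with rfl | hpos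
  -- Here `U = 0`, and `r = 0` follows from the value `t = -r / (X + 1)`, whatever `X` is.
  · have h1 : g₁ 0 = 1 := by simp [g₁]
    have h2 : g₂ 0 = 1 := by simp [g₂]
    have hU' : U = 0 := by linarith
    have hr : r = 0 := by
      have h3 := h (-r / (X + 1))
      have h4 : (-r / (X + 1)) ^ 2 * X + 2 * (-r / (X + 1)) * r + U
          = -(r ^ 2 * (X + 2)) / (X + 1) ^ 2 := by
        rw [hU']
        field_simp
        ring
      rw [h4, le_div_iff₀ (by positivity)] at h3
      nlinarith [sq_nonneg r]
    subst hr
    rw [h1, h2, hU']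
    constructor <;> linarith
  · have e1 := one_sub_g₁_sq hξ
    have e2 := g₂_sub_one_sq hξ
    have p1 := g₁_pos hξ
    have p2 := one_le_g₂ hξ
    have q1 : 0 < 1 - g₁ ξ := by
      refine lt_of_le_of_ne (sub_nonneg.mpr (g₁_le_one hξ)) fun h0 => ?_
      rw [← h0] at e1
      have := mul_pos hpos p1
      linarith
    have q2 : 0 < g₂ ξ - 1 := by
      refine lt_of_le_of_ne (sub_nonneg.mpr p2) fun h0 => ?_
      rw [← h0] at e2
      have := mul_pos hpos (zero_lt_one.trans_le p2)
      linarith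
    -- Both differences are multiplied by `|1 - g|`, after which `(1 - g)² = ξ g` turns the terms in
    -- `Z` and `U` into the hypothesis on `U`.
    constructor
    · have t1 := h (1 - g₁ ξ)
      have t2 := mul_le_mul_of_nonneg_left hU p1.le
      have : 0 ≤ (1 - g₁ ξ) * (X + 2 * r + U + Z - g₁ ξ * (X + Z)) := by
        have : (1 - g₁ ξ) * (X + 2 * r + U + Z - g₁ ξ * (X + Z))
          = ((1 - g₁ ξ) ^ 2 * X + 2 * (1 - g₁ ξ) * r + U) + (g₁ ξ * (ξ * Z) - g₁ ξ * U) := by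
          linear_combination Z * e1
        rw [this]
        linarith
      linarith [nonneg_of_mul_nonneg_right this q1]
    · have t1 := h (-(g₂ ξ - 1))
      have t2 := mul_le_mul_of_nonneg_left hU (zero_le_one.trans p2)
      have : 0 ≤ (g₂ ξ - 1) * (g₂ ξ * (X + Z) - (X + 2 * r + U + Z)) := by
        have : (g₂ ξ - 1) * (g₂ ξ * (X + Z) - (X + 2 * r + U + Z))
          = ((-(g₂ ξ - 1)) ^ 2 * X + 2 * (-(g₂ ξ - 1)) * r + U)
            + (g₂ ξ * (ξ * Z) - g₂ ξ * U) := by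
          linear_combination Z * e2
        rw [this]
        linarith
      linarith [nonneg_of_mul_nonneg_right this q2]

theorem sum_normSq_add_bounds {ι : Type*} (I : Finset ι) (x u : ι → ℂ) {ξ Z : ℝ} (hξ : 0 ≤ ξ)
    (hu : ∑ i ∈ I, Complex.normSq (u i) ≤ ξ * Z) :
    g₁ ξ * (∑ i ∈ I, Complex.normSq (x i) + Z) ≤ ∑ i ∈ I, Complex.normSq (x i + u i) + Z ∧
    ∑ i ∈ I, Complex.normSq (x i + u i) + Z ≤ g₂ ξ * (∑ i ∈ I, Complex.normSq (x i) + Z) := by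
  have key : ∀ t : ℝ, ∑ i ∈ I, Complex.normSq (t * x i + u i) =
      t ^ 2 * ∑ i ∈ I, Complex.normSq (x i)
        + 2 * t * ∑ i ∈ I, ((x i).re * (u i).re + (x i).im * (u i).im)
        + ∑ i ∈ I, Complex.normSq (u i) := by
    intro t
    simp only [Finset.mul_sum, ← Finset.sum_add_distrib]
    refine Finset.sum_congr rfl fun i _ => ?_
    simp only [Complex.normSq_apply, Complex.add_re, Complex.add_im, Complex.mul_re,
      Complex.mul_im, Complex.ofReal_re, Complex.ofReal_im]
    ring
  have h1 := key 1
  simp only [Complex.ofReal_one, one_mul, one_pow, mul_one] at h1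
  rw [h1]
  refine g₁_mul_le_and_le_g₂_mul hξ (Finset.sum_nonneg fun i _ => Complex.normSq_nonneg _) hu
    (fun t => ?_)
  rw [← key]
  exact Finset.sum_nonneg fun i _ => Complex.normSq_nonneg _

/-- The last step in bounding the norm of a symmetric matrix `H` by a bound `r` for its Rayleigh
quotients: `U`, `W` are the squared norms of `u` and `Hu`, and the hypothesis compares the form of
`H` at `u ± t Hu`. The choice `t = 1/r` is optimal. -/
theorem sq_norm_image_le {r U W : ℝ} (hr : 0 ≤ r)
    (h : ∀ t : ℝ, 0 ≤ t → 4 * t * W ≤ 2 * r * (U + t ^ 2 * W)) : W ≤ r ^ 2 * U := by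
  rcases hr.eq_or_lt with rfl | hr
  · have := h 1 zero_le_one
    nlinarith
  · have := h r⁻¹ (inv_nonneg.mpr hr.le)
    have h2 : 2 * r * (U + r⁻¹ ^ 2 * W) = (2 * r ^ 2 * U + 2 * W) / r := by
      field_simp
    have h3 : 4 * r⁻¹ * W = 4 * W / r := by
      field_simp
    rw [h2, h3, div_le_div_iff_of_pos_right hr] at this
    linarith

theorem sqrt_mul_sqrt_add_le {a b c d : ℝ} (ha : 0 ≤ a) (hb : 0 ≤ b) (hc : 0 ≤ c) (hd : 0 ≤ d) :
    √a * √b + √c * √d ≤ √(a + c) * √(b + d) := by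
  rw [← Real.sqrt_mul (add_nonneg ha hc)]
  refine Real.le_sqrt_of_sq_le ?_
  have h1 := Real.sq_sqrt ha
  have h2 := Real.sq_sqrt hb
  have h3 := Real.sq_sqrt hc
  have h4 := Real.sq_sqrt hd
  rw [← h1, ← h2, ← h3, ← h4]
  simp only [Real.sqrt_sq (Real.sqrt_nonneg _)]
  nlinarith [sq_nonneg (√a * √d - √c * √b)]

theorem abs_sum_le_sqrt_mul_sqrt {ι : Type*} (I : Finset ι) (x u : ι → ℂ) :
    |∑ i ∈ I, (star (x i) * u i).im| ≤
      √(∑ i ∈ I, Complex.normSq (x i)) * √(∑ i ∈ I, Complex.normSq (u i)) := by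
  calc |∑ i ∈ I, (star (x i) * u i).im| ≤ ∑ i ∈ I, |(star (x i) * u i).im| :=
        Finset.abs_sum_le_sum_abs _ _
    _ ≤ ∑ i ∈ I, ‖x i‖ * ‖u i‖ := Finset.sum_le_sum fun i _ => by
        refine (Complex.abs_im_le_norm _).trans ?_
        rw [norm_mul, norm_star]
    _ ≤ √(∑ i ∈ I, ‖x i‖ ^ 2) * √(∑ i ∈ I, ‖u i‖ ^ 2) :=
        Real.sum_mul_le_sqrt_mul_sqrt _ _ _
    _ = _ := by simp only [Complex.normSq_eq_norm_sq]

/-! ### The reduced eigenvalue equations and their Rayleigh quotient -/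

/-- A real matrix regarded as a complex one, in the form of the statement to be proved. -/
abbrev cplx {κ ι : Type*} (X : Matrix κ ι ℝ) : Matrix κ ι ℂ := X.map (fun r : ℝ => (r : ℂ))

theorem star_dotProduct_cplx_mulVec {κ ι : Type*} [Fintype κ] [Fintype ι] (X : Matrix κ ι ℝ)
    (y : κ → ℂ) (w : ι → ℂ) :
    star y ⬝ᵥ cplx X *ᵥ w = star ((cplx X)ᵀ *ᵥ y) ⬝ᵥ w := by
  rw [dotProduct_mulVec, star_mulVec]
  congr 2
  ext i j
  simp [conjTranspose_apply]

theorem re_star_dotProduct_cplx_mulVec {ι : Type*} [Fintype ι] (H : Matrix ι ι ℝ) (y : ι → ℂ) :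
    (star y ⬝ᵥ cplx H *ᵥ y).re = qf H y := by
  simp [qf, dotProduct, mulVec, Complex.mul_re, Complex.mul_im, ← Finset.sum_add_distrib]

theorem im_star_dotProduct_cplx_mulVec {ι : Type*} [Fintype ι] {H : Matrix ι ι ℝ}
    (hH : H.IsHermitian) (y : ι → ℂ) : (star y ⬝ᵥ cplx H *ᵥ y).im = 0 := by
  have h1 : (star y ⬝ᵥ cplx H *ᵥ y).im =
      (fun j => (y j).re) ⬝ᵥ H *ᵥ (fun j => (y j).im) -
      (fun j => (y j).im) ⬝ᵥ H *ᵥ (fun j => (y j).re) := by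
    simp only [dotProduct, ← Finset.sum_sub_distrib, Complex.im_sum]
    refine Finset.sum_congr rfl fun i _ => ?_
    simp [dotProduct, mulVec, Complex.mul_im]
    ring
  have hT : Hᵀ = H := conjTranspose_eq_transpose_of_trivial H ▸ hH
  rw [h1, dotProduct_mulVec, ← mulVec_transpose, hT, dotProduct_comm, sub_self]

/-- A symmetric matrix has norm at most `r` if its Rayleigh quotients do, by polarization. -/
theorem sum_sq_mulVec_le {ι : Type*} [Fintype ι] {H : Matrix ι ι ℝ} (hH : H.IsHermitian) {r : ℝ}
    (hr : 0 ≤ r) (h : ∀ v : ι → ℝ, |v ⬝ᵥ H *ᵥ v| ≤ r * (v ⬝ᵥ v)) (u : ι → ℝ) :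
    (H *ᵥ u) ⬝ᵥ (H *ᵥ u) ≤ r ^ 2 * (u ⬝ᵥ u) := by
  have hT : Hᵀ = H := conjTranspose_eq_transpose_of_trivial H ▸ hH
  have hs : ∀ v w : ι → ℝ, v ⬝ᵥ H *ᵥ w = (H *ᵥ v) ⬝ᵥ w := fun v w => by
    rw [dotProduct_mulVec, ← mulVec_transpose, hT]
  refine sq_norm_image_le hr fun t _ => ?_
  have h1 := (le_abs_self _).trans (h (u + t • (H *ᵥ u)))
  have h2 := (neg_le_abs _).trans (h (u - t • (H *ᵥ u)))
  simp only [mulVec_add, mulVec_sub, mulVec_smul, dotProduct_add, add_dotProduct, dotProduct_sub,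
    sub_dotProduct, smul_dotProduct, dotProduct_smul, smul_eq_mul] at h1 h2
  have e1 := hs u u
  have e2 := hs u (H *ᵥ u)
  have e3 := dotProduct_comm (H *ᵥ u) u
  have e4 := hs (H *ᵥ u) u
  rw [e2] at h1 h2
  rw [e3] at h1 h2
  nlinarith

/-- A symmetric matrix whose quadratic form lies between `lo` and `hi` has norm at most
`max |lo| |hi|`. -/
theorem sum_normSq_cplx_mulVec_le {ι : Type*} [Fintype ι] {H : Matrix ι ι ℝ}
    (hH : H.IsHermitian) {lo hi : ℝ}
    (hlo : ∀ u : ι → ℂ, lo * ∑ i, Complex.normSq (u i) ≤ qf H u)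
    (hhi : ∀ u : ι → ℂ, qf H u ≤ hi * ∑ i, Complex.normSq (u i)) (u : ι → ℂ) :
    ∑ i, Complex.normSq ((cplx H *ᵥ u) i) ≤ max (hi ^ 2) (lo ^ 2) * ∑ i, Complex.normSq (u i) := by
  have hr : ∀ v : ι → ℝ, |v ⬝ᵥ H *ᵥ v| ≤ max |hi| |lo| * (v ⬝ᵥ v) := by
    intro v
    have h1 := hlo fun i => (v i : ℂ)
    have h2 := hhi fun i => (v i : ℂ)
    have hv : ∑ i, Complex.normSq (v i : ℂ) = v ⬝ᵥ v := by simp [dotProduct]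
    have hq : qf H (fun i => (v i : ℂ)) = v ⬝ᵥ H *ᵥ v := by simp [qf, dotProduct]
    rw [hv, hq] at h1 h2
    have h0 : 0 ≤ v ⬝ᵥ v := Finset.sum_nonneg fun i _ => mul_self_nonneg _
    rw [abs_le]
    have m1 := (neg_le_abs lo).trans (le_max_right |hi| |lo|)
    have m2 := (le_abs_self hi).trans (le_max_left |hi| |lo|)
    constructor <;> nlinarith
  have hsq : max |hi| |lo| ^ 2 = max (hi ^ 2) (lo ^ 2) := by
    rw [← sq_abs hi, ← sq_abs lo]
    rcases le_total |hi| |lo| with h | h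
    · rw [max_eq_right h, max_eq_right (pow_le_pow_left₀ (abs_nonneg _) h 2)]
    · rw [max_eq_left h, max_eq_left (pow_le_pow_left₀ (abs_nonneg _) h 2)]
  have h0 : 0 ≤ max |hi| |lo| := (abs_nonneg hi).trans (le_max_left _ _)
  have a1 := sum_sq_mulVec_le hH h0 hr (fun j => (u j).re)
  have a2 := sum_sq_mulVec_le hH h0 hr (fun j => (u j).im)
  rw [hsq] at a1 a2
  have hre : ∀ j, ((cplx H *ᵥ u) j).re = (H *ᵥ fun j => (u j).re) j := fun j => by
    simp [mulVec, dotProduct]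
  have him : ∀ j, ((cplx H *ᵥ u) j).im = (H *ᵥ fun j => (u j).im) j := fun j => by
    simp [mulVec, dotProduct]
  simp only [Complex.normSq_apply, Finset.sum_add_distrib, hre, him, mul_add]
  exact add_le_add a1 a2

theorem sum_normSq_nonneg {ι : Type*} (J : Finset ι) (v : ι → ℂ) :
    0 ≤ ∑ i ∈ J, Complex.normSq (v i) :=
  Finset.sum_nonneg fun _ _ => Complex.normSq_nonneg _

theorem ofReal_sum_normSq {ι : Type*} [Fintype ι] (v : ι → ℂ) :
    ((∑ i, Complex.normSq (v i) : ℝ) : ℂ) = star v ⬝ᵥ v := by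
  rw [Complex.ofReal_sum]
  refine Finset.sum_congr rfl fun i _ => ?_
  rw [Complex.normSq_eq_conj_mul_self, Pi.star_apply, Complex.star_def]

/-- The eigenvalue equations of the preconditioned matrix in the coordinates in which `M_A`, `Ŝ`,
`M̂_S` are identities, `A` is the diagonal matrix with entries `a`, and `W_S = s`. The vectors
`x, y, z` are `U` times the eigenvector, where `U` is the upper triangular factor of the
preconditioner, and `x` is moreover rescaled so that the two blocks that couple `x` and `y` are
`diag(e) Bᵀ` and, up to the signs `-1` on `I` and `+1` off `I`, its transpose. The diagonal
matrix of the block `B diag(g) Bᵀ` is then determined by `a g = 1 ∓ e²`. -/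
structure ReducedEigen {ι κ τ : Type*} [Fintype ι] [DecidableEq ι] [Fintype κ] [Fintype τ]
    (a e g : ι → ℝ) (I : Finset ι) (s : ℝ) (B : Matrix κ ι ℝ) (C : Matrix τ κ ℝ)
    (D : Matrix τ τ ℝ) (lam : ℂ) (x : ι → ℂ) (y : κ → ℂ) (z : τ → ℂ) : Prop where
  eq_x : ∀ i, a i * x i + e i * (((cplx B)ᵀ *ᵥ y) i + ((cplx B)ᵀ *ᵥ (s : ℂ) • (cplx C)ᵀ *ᵥ z) i)
    = lam * x i
  eq_y : lam • y = cplx B *ᵥ (fun i => -((if i ∈ I then 1 else -1) * (e i * x i)) +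
    g i * (((cplx B)ᵀ *ᵥ y) i + ((cplx B)ᵀ *ᵥ (s : ℂ) • (cplx C)ᵀ *ᵥ z) i)) - (cplx C)ᵀ *ᵥ z
  eq_z : lam • z = cplx C *ᵥ (y + (s : ℂ) • (cplx C)ᵀ *ᵥ z) + cplx D *ᵥ z
    - (s : ℂ) • cplx C *ᵥ (lam • y)

namespace ReducedEigen

variable {ι κ τ : Type*} [Fintype ι] [DecidableEq ι] [Fintype κ] [Fintype τ]
    {a e g : ι → ℝ} {I : Finset ι} {s : ℝ} {B : Matrix κ ι ℝ} {C : Matrix τ κ ℝ}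
    {D : Matrix τ τ ℝ} {lam : ℂ} {x : ι → ℂ} {y : κ → ℂ} {z : τ → ℂ}

/-- The sum of the three equations of `ReducedEigen`, paired with `x`, `y`, `z`: the Rayleigh
quotient of the reduced eigenvector. -/
theorem energy (h : ReducedEigen a e g I s B C D lam x y z) {β θ : ι → ℂ} {c : κ → ℂ}
    (hβ : (cplx B)ᵀ *ᵥ y = β) (hc : (cplx C)ᵀ *ᵥ z = c)
    (hθ : (cplx B)ᵀ *ᵥ (s : ℂ) • c = θ) :
    lam * ((∑ i, Complex.normSq (x i) + ∑ j, Complex.normSq (y j) +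
        ∑ k, Complex.normSq (z k) : ℝ) : ℂ) =
      ∑ i, (star (x i) * (a i * x i + e i * (β i + θ i)) +
        star (β i - θ i) * (-((if i ∈ I then 1 else -1) * (e i * x i)) + g i * (β i + θ i))) +
      (∑ j, (star (c j) * (y j + s * c j) - star (y j - s * c j) * c j)) +
      star z ⬝ᵥ cplx D *ᵥ z := by
  have hx := h.eq_x
  have hy := h.eq_y
  have hz := h.eq_z
  rw [hβ, hc, hθ] at hx hy
  rw [hc] at hz
  set w : ι → ℂ := fun i => -((if i ∈ I then 1 else -1) * (e i * x i)) + g i * (β i + θ i) with hw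
  have nx : lam * ((∑ i, Complex.normSq (x i) : ℝ) : ℂ) =
      ∑ i, star (x i) * (a i * x i + e i * (β i + θ i)) := by
    rw [Complex.ofReal_sum, Finset.mul_sum]
    refine Finset.sum_congr rfl fun i _ => ?_
    rw [hx, Complex.normSq_eq_conj_mul_self]
    simp only [Complex.star_def]
    ring
  have hcy : ∀ v : κ → ℂ, star z ⬝ᵥ cplx C *ᵥ v = star c ⬝ᵥ v := fun v => by
    rw [star_dotProduct_cplx_mulVec, hc]
  have hr : ∀ v : κ → ℂ, star v ⬝ᵥ (lam • y) = star ((cplx B)ᵀ *ᵥ v) ⬝ᵥ w - star v ⬝ᵥ c :=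
    fun v => by rw [hy, dotProduct_sub, star_dotProduct_cplx_mulVec]
  have ny : lam * ((∑ i, Complex.normSq (y i) : ℝ) : ℂ) = star β ⬝ᵥ w - star y ⬝ᵥ c := by
    rw [ofReal_sum_normSq, ← smul_eq_mul, ← dotProduct_smul, hr, hβ]
  have nz : lam * ((∑ i, Complex.normSq (z i) : ℝ) : ℂ) = star c ⬝ᵥ (y + (s : ℂ) • c)
      + star z ⬝ᵥ cplx D *ᵥ z - (star θ ⬝ᵥ w - star ((s : ℂ) • c) ⬝ᵥ c) := by
    rw [ofReal_sum_normSq, ← smul_eq_mul, ← dotProduct_smul, hz, dotProduct_sub, dotProduct_add, hcy,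
      dotProduct_smul, hcy]
    congr 1
    rw [← hθ, ← hr, star_smul, smul_dotProduct]
    simp
  push_cast at nx ny nz ⊢
  rw [mul_add, mul_add, nx, ny, nz]
  simp only [dotProduct, Finset.sum_add_distrib, Finset.sum_sub_distrib, star_sub, sub_mul,
    Pi.star_apply, Pi.add_apply, Pi.smul_apply, smul_eq_mul, hw]
  ring

theorem sum_add_sum_compl_eq_sum_ite {M : Type*} [AddCommMonoid M] (I : Finset ι) (f f' : ι → M) :
    ∑ i ∈ I, f i + ∑ i ∈ Iᶜ, f' i = ∑ i, if i ∈ I then f i else f' i := by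
  rw [← Finset.sum_add_sum_compl I]
  congr 1
  · exact Finset.sum_congr rfl fun i hi => (if_pos hi).symm
  · exact Finset.sum_congr rfl fun i hi => (if_neg (Finset.mem_compl.mp hi)).symm

/-- The real part of `energy`, with the squares in `x` completed. -/
theorem re_energy (h : ReducedEigen a e g I s B C D lam x y z) {β θ : ι → ℂ} {c : κ → ℂ}
    (hβ : (cplx B)ᵀ *ᵥ y = β) (hc : (cplx C)ᵀ *ᵥ z = c)
    (hθ : (cplx B)ᵀ *ᵥ (s : ℂ) • c = θ) (ha : ∀ i, 0 < a i)
    (hg : ∀ i, a i * g i = 1 - (if i ∈ I then 1 else -1) * e i ^ 2) :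
    lam.re * (∑ i, Complex.normSq (x i) + ∑ j, Complex.normSq (y j) +
        ∑ k, Complex.normSq (z k)) =
      (∑ i ∈ I, a i * Complex.normSq (x i + (e i / a i : ℝ) * θ i) +
        (qf D z + 2 * s * ∑ j, Complex.normSq (c j) -
          ∑ i, (if i ∈ I then 1 / a i else g i) * Complex.normSq (θ i))) +
      (∑ i ∈ Iᶜ, a i * Complex.normSq (x i + (e i / a i : ℝ) * β i) +
        ∑ i, (if i ∈ I then g i else 1 / a i) * Complex.normSq (β i)) := by
  have h1 := congrArg Complex.re (h.energy hβ hc hθ)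
  rw [Complex.re_mul_ofReal, Complex.add_re, Complex.add_re, re_star_dotProduct_cplx_mulVec,
    Complex.re_sum, Complex.re_sum] at h1
  rw [h1]
  have h2 : (∑ j, (star (c j) * (y j + s * c j) - star (y j - s * c j) * c j).re) =
      2 * s * ∑ j, Complex.normSq (c j) := by
    rw [Finset.mul_sum]
    refine Finset.sum_congr rfl fun j _ => ?_
    simp [Complex.mul_re, Complex.mul_im, Complex.normSq_apply]
    ring
  have h3 : (∑ i, (star (x i) * (a i * x i + e i * (β i + θ i)) +
        star (β i - θ i) * (-((if i ∈ I then 1 else -1) * (e i * x i)) +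
          g i * (β i + θ i))).re) =
      (∑ i ∈ I, a i * Complex.normSq (x i + (e i / a i : ℝ) * θ i) +
        ∑ i ∈ Iᶜ, a i * Complex.normSq (x i + (e i / a i : ℝ) * β i)) +
      (∑ i, (if i ∈ I then g i else 1 / a i) * Complex.normSq (β i) -
        ∑ i, (if i ∈ I then 1 / a i else g i) * Complex.normSq (θ i)) := by
    rw [sum_add_sum_compl_eq_sum_ite, ← Finset.sum_sub_distrib, ← Finset.sum_add_distrib]
    refine Finset.sum_congr rfl fun i _ => ?_
    have hai := (ha i).ne'
    have hgi := hg i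
    by_cases hi : i ∈ I
    · simp only [if_pos hi] at hgi ⊢
      have hgi' : g i = (1 - e i * e i) / a i := by
        rw [eq_div_iff hai]
        linarith
      rw [hgi']
      simp [Complex.mul_re, Complex.mul_im, Complex.normSq_apply]
      field_simp
      ring
    · simp only [if_neg hi] at hgi ⊢
      have hgi' : g i = (1 + e i * e i) / a i := by
        rw [eq_div_iff hai]
        linarith
      rw [hgi']
      simp [Complex.mul_re, Complex.mul_im, Complex.normSq_apply]
      field_simp
      ring
  rw [h2, h3]
  ring

theorem im_energy (h : ReducedEigen a e g I s B C D lam x y z) (hD : D.IsHermitian)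
    {β θ : ι → ℂ} {c : κ → ℂ}
    (hβ : (cplx B)ᵀ *ᵥ y = β) (hc : (cplx C)ᵀ *ᵥ z = c)
    (hθ : (cplx B)ᵀ *ᵥ (s : ℂ) • c = θ) :
    lam.im * (∑ i, Complex.normSq (x i) + ∑ j, Complex.normSq (y j) +
        ∑ k, Complex.normSq (z k)) =
      2 * (∑ i ∈ I, (star (x i) * (e i * β i)).im + (∑ i ∈ Iᶜ, (star (x i) * (e i * θ i)).im +
        ∑ j, (star (y j) * (cplx B *ᵥ (fun i => g i * θ i) - c) j).im)) := by
  have h1 := congrArg Complex.im (h.energy hβ hc hθ)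
  rw [Complex.im_mul_ofReal, Complex.add_im, Complex.add_im, im_star_dotProduct_cplx_mulVec hD,
    Complex.im_sum, Complex.im_sum] at h1
  rw [h1]
  have h2 : (∑ j, (star (c j) * (y j + s * c j) - star (y j - s * c j) * c j).im) =
      -(2 * ∑ j, (star (y j) * c j).im) := by
    rw [Finset.mul_sum, ← Finset.sum_neg_distrib]
    refine Finset.sum_congr rfl fun j _ => ?_
    simp [Complex.mul_re, Complex.mul_im]
    ring
  have h4 : ∑ j, (star (y j) * (cplx B *ᵥ (fun i => g i * θ i) - c) j).im =
      ∑ i, (star (β i) * (g i * θ i)).im - ∑ j, (star (y j) * c j).im := by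
    have := congrArg Complex.im (star_dotProduct_cplx_mulVec B y fun i => g i * θ i)
    rw [hβ] at this
    simp only [dotProduct, Complex.im_sum, Pi.star_apply] at this
    simp only [Pi.sub_apply, mul_sub, Complex.sub_im, Finset.sum_sub_distrib, this]
  have h3 : (∑ i, (star (x i) * (a i * x i + e i * (β i + θ i)) +
        star (β i - θ i) * (-((if i ∈ I then 1 else -1) * (e i * x i)) +
          g i * (β i + θ i))).im) =
      2 * (∑ i ∈ I, (star (x i) * (e i * β i)).im + ∑ i ∈ Iᶜ, (star (x i) * (e i * θ i)).im) +
        2 * ∑ i, (star (β i) * (g i * θ i)).im := by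
    rw [sum_add_sum_compl_eq_sum_ite, Finset.mul_sum, Finset.mul_sum, ← Finset.sum_add_distrib]
    refine Finset.sum_congr rfl fun i _ => ?_
    by_cases hi : i ∈ I
    · simp [hi, Complex.mul_re, Complex.mul_im]
      ring
    · simp [hi, Complex.mul_re, Complex.mul_im]
      ring
  rw [h2, h3, h4]
  ring

/-- Bounds for the real part. The Rayleigh quotient splits into a form in `x|_I, z` and a form in
`x` off `I` and `y`; each is a block diagonal form with bounds `m, M` composed with a unit
triangular block matrix, whence the factors `g₁`, `g₂`. -/
theorem re_bounds (h : ReducedEigen a e g I s B C D lam x y z)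
    {β θ : ι → ℂ} {c : κ → ℂ}
    (hβ : (cplx B)ᵀ *ᵥ y = β) (hc : (cplx C)ᵀ *ᵥ z = c)
    (hθ : (cplx B)ᵀ *ᵥ (s : ℂ) • c = θ) (ha : ∀ i, 0 < a i)
    (hg : ∀ i, a i * g i = 1 - (if i ∈ I then 1 else -1) * e i ^ 2)
    (hN : 0 < ∑ i, Complex.normSq (x i) + ∑ j, Complex.normSq (y j) +
        ∑ k, Complex.normSq (z k))
    {m₁ M₁ m₂ M₂ ξ₁ ξ₂ lo hi : ℝ} (hξ₁ : 0 ≤ ξ₁) (hξ₂ : 0 ≤ ξ₂)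
    (hm₁ : 0 ≤ m₁) (hM₁ : 0 ≤ M₁) (hm₂ : 0 ≤ m₂) (hM₂ : 0 ≤ M₂)
    (ha₁ : ∀ i ∈ I, m₁ ≤ a i ∧ a i ≤ M₁) (ha₂ : ∀ i ∉ I, m₂ ≤ a i ∧ a i ≤ M₂)
    (hR₁ : m₁ * ∑ k, Complex.normSq (z k) ≤ qf D z + 2 * s * ∑ j, Complex.normSq (c j) -
          ∑ i, (if i ∈ I then 1 / a i else g i) * Complex.normSq (θ i))
    (hR₂ : qf D z + 2 * s * ∑ j, Complex.normSq (c j) -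
          ∑ i, (if i ∈ I then 1 / a i else g i) * Complex.normSq (θ i)
        ≤ M₁ * ∑ k, Complex.normSq (z k))
    (hK₁ : m₂ * ∑ j, Complex.normSq (y j) ≤
      ∑ i, (if i ∈ I then g i else 1 / a i) * Complex.normSq (β i))
    (hK₂ : ∑ i, (if i ∈ I then g i else 1 / a i) * Complex.normSq (β i) ≤
      M₂ * ∑ j, Complex.normSq (y j))
    (hu₁ : ∑ i ∈ I, Complex.normSq ((e i / a i : ℝ) * θ i) ≤ ξ₁ * ∑ k, Complex.normSq (z k))
    (hu₂ : ∑ i ∈ Iᶜ, Complex.normSq ((e i / a i : ℝ) * β i) ≤ ξ₂ * ∑ j, Complex.normSq (y j))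
    (hlo₁ : lo ≤ m₁ * g₁ ξ₁) (hlo₂ : lo ≤ m₂ * g₁ ξ₂)
    (hhi₁ : M₁ * g₂ ξ₁ ≤ hi) (hhi₂ : M₂ * g₂ ξ₂ ≤ hi) :
    lo ≤ lam.re ∧ lam.re ≤ hi := by
  have hE := h.re_energy hβ hc hθ ha hg
  obtain ⟨b1, b2⟩ := sum_normSq_add_bounds I x (fun i => (e i / a i : ℝ) * θ i) hξ₁ hu₁
  obtain ⟨b3, b4⟩ := sum_normSq_add_bounds Iᶜ x (fun i => (e i / a i : ℝ) * β i) hξ₂ hu₂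
  have c1 : m₁ * ∑ i ∈ I, Complex.normSq (x i + (e i / a i : ℝ) * θ i) ≤
      ∑ i ∈ I, a i * Complex.normSq (x i + (e i / a i : ℝ) * θ i) := by
    rw [Finset.mul_sum]
    exact Finset.sum_le_sum fun i hi =>
      mul_le_mul_of_nonneg_right (ha₁ i hi).1 (Complex.normSq_nonneg _)
  have c2 : ∑ i ∈ I, a i * Complex.normSq (x i + (e i / a i : ℝ) * θ i) ≤
      M₁ * ∑ i ∈ I, Complex.normSq (x i + (e i / a i : ℝ) * θ i) := by
    rw [Finset.mul_sum]
    exact Finset.sum_le_sum fun i hi =>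
      mul_le_mul_of_nonneg_right (ha₁ i hi).2 (Complex.normSq_nonneg _)
  have c3 : m₂ * ∑ i ∈ Iᶜ, Complex.normSq (x i + (e i / a i : ℝ) * β i) ≤
      ∑ i ∈ Iᶜ, a i * Complex.normSq (x i + (e i / a i : ℝ) * β i) := by
    rw [Finset.mul_sum]
    exact Finset.sum_le_sum fun i hi =>
      mul_le_mul_of_nonneg_right (ha₂ i (Finset.mem_compl.mp hi)).1 (Complex.normSq_nonneg _)
  have c4 : ∑ i ∈ Iᶜ, a i * Complex.normSq (x i + (e i / a i : ℝ) * β i) ≤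
      M₂ * ∑ i ∈ Iᶜ, Complex.normSq (x i + (e i / a i : ℝ) * β i) := by
    rw [Finset.mul_sum]
    exact Finset.sum_le_sum fun i hi =>
      mul_le_mul_of_nonneg_right (ha₂ i (Finset.mem_compl.mp hi)).2 (Complex.normSq_nonneg _)
  rw [← Finset.sum_add_sum_compl I fun i => Complex.normSq (x i)] at hN hE
  have hX₁ := sum_normSq_nonneg I x
  have hX₂ := sum_normSq_nonneg Iᶜ x
  have hY := sum_normSq_nonneg Finset.univ y
  have hZ := sum_normSq_nonneg Finset.univ z
  have d1 := mul_le_mul_of_nonneg_left b1 hm₁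
  have d2 := mul_le_mul_of_nonneg_left b2 hM₁
  have d3 := mul_le_mul_of_nonneg_left b3 hm₂
  have d4 := mul_le_mul_of_nonneg_left b4 hM₂
  have f1 := mul_le_mul_of_nonneg_right hlo₁ (add_nonneg hX₁ hZ)
  have f2 := mul_le_mul_of_nonneg_right hhi₁ (add_nonneg hX₁ hZ)
  have f3 := mul_le_mul_of_nonneg_right hlo₂ (add_nonneg hX₂ hY)
  have f4 := mul_le_mul_of_nonneg_right hhi₂ (add_nonneg hX₂ hY)
  constructor
  · refine le_of_mul_le_mul_right ?_ hN
    rw [hE]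
    linarith
  · refine le_of_mul_le_mul_right ?_ hN
    rw [hE]
    linarith

/-- Bound for the imaginary part: the skew part of the reduced matrix couples `(x|_I, z)` with
`(y, x off I)` only. -/
theorem abs_im_le (h : ReducedEigen a e g I s B C D lam x y z) (hD : D.IsHermitian)
    {β θ : ι → ℂ} {c : κ → ℂ}
    (hβ : (cplx B)ᵀ *ᵥ y = β) (hc : (cplx C)ᵀ *ᵥ z = c)
    (hθ : (cplx B)ᵀ *ᵥ (s : ℂ) • c = θ)
    (hN : 0 < ∑ i, Complex.normSq (x i) + ∑ j, Complex.normSq (y j) +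
        ∑ k, Complex.normSq (z k))
    {P L : ℝ} (hP : 0 ≤ P) (hL : 0 ≤ L)
    (h₁ : ∑ i ∈ I, Complex.normSq (e i * β i) ≤ L * ∑ j, Complex.normSq (y j))
    (h₂ : ∑ i ∈ Iᶜ, Complex.normSq (e i * θ i) +
      ∑ j, Complex.normSq ((cplx B *ᵥ (fun i => g i * θ i) - c) j) ≤
        P * ∑ k, Complex.normSq (z k)) :
    |lam.im| ≤ √(P + L) := by
  have hE := h.im_energy hD hβ hc hθ
  rw [← Finset.sum_add_sum_compl I fun i => Complex.normSq (x i)] at hN hE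
  have t1 := abs_sum_le_sqrt_mul_sqrt I x fun i => e i * β i
  have t2 := abs_sum_le_sqrt_mul_sqrt Iᶜ x fun i => e i * θ i
  have t3 := abs_sum_le_sqrt_mul_sqrt Finset.univ y (cplx B *ᵥ (fun i => g i * θ i) - c)
  set X₁ := ∑ i ∈ I, Complex.normSq (x i)
  set X₂ := ∑ i ∈ Iᶜ, Complex.normSq (x i)
  set Y := ∑ j, Complex.normSq (y j)
  set Z := ∑ k, Complex.normSq (z k)
  have hX₁ : 0 ≤ X₁ := sum_normSq_nonneg I x
  have hX₂ : 0 ≤ X₂ := sum_normSq_nonneg Iᶜ x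
  have hY : 0 ≤ Y := sum_normSq_nonneg Finset.univ y
  have hZ : 0 ≤ Z := sum_normSq_nonneg Finset.univ z
  have s1 : √X₁ * √(∑ i ∈ I, Complex.normSq (e i * β i)) ≤ √L * √(X₁ * Y) := by
    refine (mul_le_mul_of_nonneg_left (Real.sqrt_le_sqrt h₁) (Real.sqrt_nonneg _)).trans_eq ?_
    rw [Real.sqrt_mul hL, Real.sqrt_mul hX₁]
    ring
  have s2 := sqrt_mul_sqrt_add_le hX₂ (sum_normSq_nonneg Iᶜ fun i => e i * θ i) hY
    (sum_normSq_nonneg Finset.univ (cplx B *ᵥ (fun i => g i * θ i) - c))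
  have s3 : √(X₂ + Y) * √(∑ i ∈ Iᶜ, Complex.normSq (e i * θ i) +
      ∑ j, Complex.normSq ((cplx B *ᵥ (fun i => g i * θ i) - c) j)) ≤
        √P * √((X₂ + Y) * Z) := by
    refine (mul_le_mul_of_nonneg_left (Real.sqrt_le_sqrt h₂) (Real.sqrt_nonneg _)).trans_eq ?_
    rw [Real.sqrt_mul hP, Real.sqrt_mul (add_nonneg hX₂ hY)]
    ring
  have s4 := sqrt_mul_sqrt_add_le hP (mul_nonneg (add_nonneg hX₂ hY) hZ) hL (mul_nonneg hX₁ hY)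
  -- `(X₁ + Z) (X₂ + Y)` dominates the radicand and is at most a quarter of the squared total norm.
  have s5 : √((X₂ + Y) * Z + X₁ * Y) ≤ (X₁ + X₂ + Y + Z) / 2 := by
    refine Real.sqrt_le_iff.mpr ⟨by linarith, ?_⟩
    nlinarith [sq_nonneg (X₁ + Z - (X₂ + Y)), mul_nonneg hX₁ hX₂]
  have s6 := mul_le_mul_of_nonneg_left s5 (Real.sqrt_nonneg (P + L))
  refine le_of_mul_le_mul_right ?_ hN
  rw [← abs_of_pos hN, ← abs_mul, hE, abs_mul, abs_two, abs_of_pos hN]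
  have a1 := abs_add_le (∑ i ∈ I, (star (x i) * (e i * β i)).im)
    (∑ i ∈ Iᶜ, (star (x i) * (e i * θ i)).im +
        ∑ j, (star (y j) * (cplx B *ᵥ (fun i => g i * θ i) - c) j).im)
  have a2 := abs_add_le (∑ i ∈ Iᶜ, (star (x i) * (e i * θ i)).im)
    (∑ j, (star (y j) * (cplx B *ᵥ (fun i => g i * θ i) - c) j).im)
  linarith

end ReducedEigen

/-! ### Data in normalized coordinates -/

/-- The data after a change of coordinates that turns `M_A`, `Ŝ`, `M̂_S` into identities and `A`
into the diagonal matrix with entries `a`; `s` is the scalar to which `W_S` reduces. -/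
structure Normalized {n m l : ℕ} (P : Data n m l) (a : Fin n → ℝ) (s : ℝ) : Prop where
  m_pos : 0 < m
  l_pos : 0 < l
  n_pos : 0 < n
  MA_eq : P.MA = 1
  Sh_eq : P.Sh = 1
  MSh_eq : P.MSh = 1
  A_eq : P.A = diagonal a
  a_pos : ∀ i, 0 < a i
  D_psd : P.D.PosSemidef
  WS_eq : P.WS = s • (1 : Matrix (Fin m) (Fin m) ℝ)
  s_eq : s = 0 ∨ s = 1

namespace Normalized

variable {n m l : ℕ} {P : Data n m l} {a : Fin n → ℝ} {s : ℝ}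

theorem nonempty_n (N : Normalized P a s) : Nonempty (Fin n) := ⟨⟨0, N.n_pos⟩⟩
theorem nonempty_m (N : Normalized P a s) : Nonempty (Fin m) := ⟨⟨0, N.m_pos⟩⟩
theorem nonempty_l (N : Normalized P a s) : Nonempty (Fin l) := ⟨⟨0, N.l_pos⟩⟩

theorem s_nonneg (N : Normalized P a s) : 0 ≤ s := by
  rcases N.s_eq with h | h <;> rw [h]
  exact zero_le_one

theorem s_sq (N : Normalized P a s) : s * s = s := by
  rcases N.s_eq with h | h <;> rw [h] <;> norm_num

theorem A_inv (N : Normalized P a s) : P.A⁻¹ = diagonal fun i => 1 / a i := by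
  rw [N.A_eq]
  refine inv_eq_right_inv ?_
  rw [diagonal_mul_diagonal, ← diagonal_one]
  congr 1
  ext i
  rw [mul_one_div_cancel (N.a_pos i).ne']

theorem S_psd (N : Normalized P a s) : P.S.PosSemidef := by
  rw [Data.S, N.A_inv, ← conjTranspose_eq_transpose_of_trivial P.B]
  exact (PosSemidef.diagonal fun i => (one_div_pos.mpr (N.a_pos i)).le).mul_mul_conjTranspose_same _

theorem CCT_psd (P : Data n m l) : (P.C * P.Cᵀ).PosSemidef := by
  rw [← conjTranspose_eq_transpose_of_trivial P.C]
  exact posSemidef_self_mul_conjTranspose _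

theorem qf_S (N : Normalized P a s) (y : Fin m → ℂ) :
    qf P.S y = ∑ i, 1 / a i * Complex.normSq (((cplx P.B)ᵀ *ᵥ y) i) := by
  have h := qf_congr P.Bᵀ (diagonal fun i => 1 / a i) y
  rw [transpose_transpose, qf_diagonal] at h
  rw [Data.S, N.A_inv, h]
  rfl

theorem qf_CCT (P : Data n m l) (z : Fin l → ℂ) :
    qf (P.C * P.Cᵀ) z = ∑ j, Complex.normSq (((cplx P.C)ᵀ *ᵥ z) j) := by
  have h := qf_congr P.Cᵀ (diagonal fun _ => 1) z
  rw [transpose_transpose, qf_diagonal, diagonal_one, Matrix.mul_one] at h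
  rw [h]
  simp only [one_mul]
  rfl

/-! ### The extreme eigenvalues in normalized coordinates -/

theorem mu_mat (N : Normalized P a s) : P.MA⁻¹ * P.A = diagonal a := by
  rw [N.MA_eq, N.A_eq, inv_one, one_mul]

theorem nu_mat (N : Normalized P a s) : P.Sh⁻¹ * P.S = P.S := by
  rw [N.Sh_eq, inv_one, one_mul]

theorem omega_mat (N : Normalized P a s) : P.MSh⁻¹ * P.C * P.Sh⁻¹ * P.Cᵀ = P.C * P.Cᵀ := by
  rw [N.Sh_eq, N.MSh_eq, inv_one, inv_one, Matrix.one_mul, Matrix.mul_one]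

theorem tau_mat (N : Normalized P a s) : P.MSh⁻¹ * P.D = P.D := by
  rw [N.MSh_eq, inv_one, one_mul]

theorem varphi_mat (N : Normalized P a s) : P.WS * P.S = s • P.S := by
  rw [N.WS_eq, smul_mul_assoc, one_mul]

theorem phi_mat (N : Normalized P a s) : P.MSh⁻¹ * P.C * P.WS * P.Cᵀ = s • (P.C * P.Cᵀ) := by
  rw [N.MSh_eq, N.WS_eq, inv_one, Matrix.one_mul, Matrix.mul_smul, Matrix.mul_one,
    Matrix.smul_mul]

theorem kappa_mat (N : Normalized P a s) :
    P.MSh⁻¹ * (P.D + P.C * P.WS * P.Cᵀ) = P.D + s • (P.C * P.Cᵀ) := by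
  rw [N.MSh_eq, N.WS_eq, inv_one, Matrix.one_mul, Matrix.mul_smul, Matrix.mul_one,
    Matrix.smul_mul]

theorem muMin_le (N : Normalized P a s) (i : Fin n) : P.muMin ≤ a i := by
  rw [Data.muMin, N.mu_mat]
  exact lamMin_le (mem_eigs_diagonal a i)

theorem le_muMax (N : Normalized P a s) (i : Fin n) : a i ≤ P.muMax := by
  rw [Data.muMax, N.mu_mat]
  exact le_lamMax (mem_eigs_diagonal a i)

theorem muMin_pos (N : Normalized P a s) : 0 < P.muMin := by
  have := N.nonempty_n
  have h := lamMin_mem (isHermitian_diagonal a)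
  rw [eigs_diagonal] at h
  obtain ⟨i, hi⟩ := h
  rw [Data.muMin, N.mu_mat, ← hi]
  exact N.a_pos i

theorem muMin_le_muMax (N : Normalized P a s) : P.muMin ≤ P.muMax :=
  (N.muMin_le ⟨0, N.n_pos⟩).trans (N.le_muMax _)

theorem nuMin_nonneg (N : Normalized P a s) : 0 ≤ P.nuMin := by
  have := N.nonempty_m
  rw [Data.nuMin, N.nu_mat]
  exact lamMin_nonneg N.S_psd

theorem nuMin_le_nuMax (N : Normalized P a s) : P.nuMin ≤ P.nuMax := by
  have := N.nonempty_m
  rw [Data.nuMin, Data.nuMax, N.nu_mat]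
  exact lamMin_le_lamMax N.S_psd.1

theorem nuMin_mul_le (N : Normalized P a s) (y : Fin m → ℂ) :
    P.nuMin * ∑ j, Complex.normSq (y j) ≤
      ∑ i, 1 / a i * Complex.normSq (((cplx P.B)ᵀ *ᵥ y) i) := by
  rw [← N.qf_S, Data.nuMin, N.nu_mat]
  exact lamMin_mul_le_qf N.S_psd.1 y

theorem le_nuMax_mul (N : Normalized P a s) (y : Fin m → ℂ) :
    ∑ i, 1 / a i * Complex.normSq (((cplx P.B)ᵀ *ᵥ y) i) ≤
      P.nuMax * ∑ j, Complex.normSq (y j) := by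
  rw [← N.qf_S, Data.nuMax, N.nu_mat]
  exact qf_le_lamMax_mul N.S_psd.1 y

theorem varphi_psd (N : Normalized P a s) : (s • P.S).PosSemidef := N.S_psd.smul N.s_nonneg

theorem varphiMin_nonneg (N : Normalized P a s) : 0 ≤ P.varphiMin := by
  have := N.nonempty_m
  rw [Data.varphiMin, N.varphi_mat]
  exact lamMin_nonneg N.varphi_psd

theorem varphiMin_le_varphiMax (N : Normalized P a s) : P.varphiMin ≤ P.varphiMax := by
  have := N.nonempty_m
  rw [Data.varphiMin, Data.varphiMax, N.varphi_mat]
  exact lamMin_le_lamMax N.varphi_psd.1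

theorem lamMax_zero {k : ℕ} [Nonempty (Fin k)] : lamMax (0 : Matrix (Fin k) (Fin k) ℝ) = 0 := by
  have h := lamMax_mem (isHermitian_zero (n := Fin k) (α := ℝ))
  rw [← diagonal_zero, eigs_diagonal] at h
  obtain ⟨_, hi⟩ := h
  rw [← diagonal_zero]
  exact hi.symm

theorem varphiMax_le_nuMax (N : Normalized P a s) : P.varphiMax ≤ P.nuMax := by
  have := N.nonempty_m
  rcases N.s_eq with h | h
  · rw [Data.varphiMax, N.varphi_mat, h, zero_smul, lamMax_zero]
    exact N.nuMin_nonneg.trans N.nuMin_le_nuMax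
  · rw [Data.varphiMax, Data.nuMax, N.varphi_mat, N.nu_mat, h, one_smul]

theorem varphi_form (N : Normalized P a s) (c : Fin m → ℂ) :
    ∑ i, 1 / a i * Complex.normSq (((cplx P.B)ᵀ *ᵥ ((s : ℂ) • c)) i) = qf (s • P.S) c := by
  rw [qf_smul, N.qf_S, ← N.s_sq, mul_assoc, N.s_sq, Finset.mul_sum, Finset.mul_sum]
  refine Finset.sum_congr rfl fun i _ => ?_
  rw [mulVec_smul, Pi.smul_apply, smul_eq_mul, Complex.normSq_mul, Complex.normSq_ofReal]
  ring

theorem varphiMin_mul_le (N : Normalized P a s) (c : Fin m → ℂ) :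
    P.varphiMin * (s * ∑ j, Complex.normSq (c j)) ≤
      ∑ i, 1 / a i * Complex.normSq (((cplx P.B)ᵀ *ᵥ ((s : ℂ) • c)) i) := by
  have h := lamMin_mul_le_qf N.varphi_psd.1 c
  rw [N.varphi_form, Data.varphiMin, N.varphi_mat]
  rcases N.s_eq with h0 | h0
  · rw [qf_smul, h0]
    simp
  · rwa [h0, one_mul, ← h0]

theorem le_varphiMax_mul (N : Normalized P a s) (c : Fin m → ℂ) :
    ∑ i, 1 / a i * Complex.normSq (((cplx P.B)ᵀ *ᵥ ((s : ℂ) • c)) i) ≤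
      P.varphiMax * (s * ∑ j, Complex.normSq (c j)) := by
  have h := qf_le_lamMax_mul N.varphi_psd.1 c
  rw [N.varphi_form, Data.varphiMax, N.varphi_mat]
  rcases N.s_eq with h0 | h0
  · rw [qf_smul, h0]
    simp
  · rwa [h0, one_mul, ← h0]

theorem phi_psd (N : Normalized P a s) : (s • (P.C * P.Cᵀ)).PosSemidef :=
  (CCT_psd P).smul N.s_nonneg

theorem phiMin_nonneg (N : Normalized P a s) : 0 ≤ P.phiMin := by
  have := N.nonempty_l
  rw [Data.phiMin, N.phi_mat]
  exact lamMin_nonneg N.phi_psd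

theorem phiMin_le_phiMax (N : Normalized P a s) : P.phiMin ≤ P.phiMax := by
  have := N.nonempty_l
  rw [Data.phiMin, Data.phiMax, N.phi_mat]
  exact lamMin_le_lamMax N.phi_psd.1

theorem phiMin_mul_le (N : Normalized P a s) (z : Fin l → ℂ) :
    P.phiMin * ∑ k, Complex.normSq (z k) ≤
      s * ∑ j, Complex.normSq (((cplx P.C)ᵀ *ᵥ z) j) := by
  rw [← qf_CCT, ← qf_smul, Data.phiMin, N.phi_mat]
  exact lamMin_mul_le_qf N.phi_psd.1 z

theorem le_phiMax_mul (N : Normalized P a s) (z : Fin l → ℂ) :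
    s * ∑ j, Complex.normSq (((cplx P.C)ᵀ *ᵥ z) j) ≤
      P.phiMax * ∑ k, Complex.normSq (z k) := by
  rw [← qf_CCT, ← qf_smul, Data.phiMax, N.phi_mat]
  exact qf_le_lamMax_mul N.phi_psd.1 z

theorem tauMin_nonneg (N : Normalized P a s) : 0 ≤ P.tauMin := by
  have := N.nonempty_l
  rw [Data.tauMin, N.tau_mat]
  exact lamMin_nonneg N.D_psd

theorem tauMin_mul_le (N : Normalized P a s) (z : Fin l → ℂ) :
    P.tauMin * ∑ k, Complex.normSq (z k) ≤ qf P.D z := by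
  rw [Data.tauMin, N.tau_mat]
  exact lamMin_mul_le_qf N.D_psd.1 z

theorem le_tauMax_mul (N : Normalized P a s) (z : Fin l → ℂ) :
    qf P.D z ≤ P.tauMax * ∑ k, Complex.normSq (z k) := by
  rw [Data.tauMax, N.tau_mat]
  exact qf_le_lamMax_mul N.D_psd.1 z

theorem kappa_psd (N : Normalized P a s) : (P.D + s • (P.C * P.Cᵀ)).PosSemidef :=
  N.D_psd.add N.phi_psd

theorem kappaMin_nonneg (N : Normalized P a s) : 0 ≤ P.kappaMin := by
  have := N.nonempty_l
  rw [Data.kappaMin, N.kappa_mat]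
  exact lamMin_nonneg N.kappa_psd

theorem kappaMin_mul_le (N : Normalized P a s) (z : Fin l → ℂ) :
    P.kappaMin * ∑ k, Complex.normSq (z k) ≤
      qf P.D z + s * ∑ j, Complex.normSq (((cplx P.C)ᵀ *ᵥ z) j) := by
  rw [← qf_CCT, ← qf_smul, ← qf_add, Data.kappaMin, N.kappa_mat]
  exact lamMin_mul_le_qf N.kappa_psd.1 z

theorem le_kappaMax_mul (N : Normalized P a s) (z : Fin l → ℂ) :
    qf P.D z + s * ∑ j, Complex.normSq (((cplx P.C)ᵀ *ᵥ z) j) ≤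
      P.kappaMax * ∑ k, Complex.normSq (z k) := by
  rw [← qf_CCT, ← qf_smul, ← qf_add, Data.kappaMax, N.kappa_mat]
  exact qf_le_lamMax_mul N.kappa_psd.1 z

theorem le_omegaMax_mul (N : Normalized P a s) (z : Fin l → ℂ) :
    ∑ j, Complex.normSq (((cplx P.C)ᵀ *ᵥ z) j) ≤
      P.omegaMax * ∑ k, Complex.normSq (z k) := by
  rw [← qf_CCT, Data.omegaMax, N.omega_mat]
  exact qf_le_lamMax_mul (CCT_psd P).1 z

theorem omegaMax_nonneg (N : Normalized P a s) : 0 ≤ P.omegaMax := by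
  have := N.nonempty_l
  rw [Data.omegaMax, N.omega_mat]
  exact (lamMin_nonneg (CCT_psd P)).trans (lamMin_le_lamMax (CCT_psd P).1)

theorem phiMax_eq_of_s_eq_zero (N : Normalized P a s) (h : s = 0) : P.phiMax = 0 := by
  have := N.nonempty_l
  rw [Data.phiMax, N.phi_mat, h, zero_smul, lamMax_zero]

theorem phiMax_eq_of_s_eq_one (N : Normalized P a s) (h : s = 1) : P.phiMax = P.omegaMax := by
  rw [Data.phiMax, Data.omegaMax, N.phi_mat, N.omega_mat, h, one_smul]

theorem phiMax_le_omegaMax (N : Normalized P a s) : P.phiMax ≤ P.omegaMax := by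
  rcases N.s_eq with h | h
  · rw [N.phiMax_eq_of_s_eq_zero h]
    exact N.omegaMax_nonneg
  · rw [N.phiMax_eq_of_s_eq_one h]

theorem phiMax_nonneg (N : Normalized P a s) : 0 ≤ P.phiMax :=
  N.phiMin_nonneg.trans N.phiMin_le_phiMax

theorem varphiMax_nonneg (N : Normalized P a s) : 0 ≤ P.varphiMax :=
  N.varphiMin_nonneg.trans N.varphiMin_le_varphiMax

/-- The lower bound of `schur_bounds` is nonnegative; this is where `ν̄ ≤ 2` and `μ̄ν̄ ≤ 2` enter. -/
theorem hMin_add_nonneg (N : Normalized P a s) {t : ℝ} (ht : t ≤ 2) :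
    0 ≤ P.hMin t + P.phiMin * (1 - t) := by
  have h1 := N.phiMin_nonneg
  have h2 := N.tauMin_nonneg
  have h3 := N.kappaMin_nonneg
  unfold Data.hMin
  split_ifs with h
  · exact add_nonneg h3 (mul_nonneg h1 (by linarith))
  · have := mul_nonneg h1 (show 0 ≤ 2 - t by linarith)
    linarith

/-- Bounds for `D + 2 C W_S Cᵀ - C W_S H W_S Cᵀ`, where `H` is a matrix whose form on the range
of `W_S` lies between `t'` and `t`. One copy of `C W_S Cᵀ` is joined to `D` if `t ≤ 1`, and both
copies to `-C W_S H W_S Cᵀ` otherwise, so that the remaining coefficient stays nonnegative. -/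
theorem schur_bounds (N : Normalized P a s) (z : Fin l → ℂ) {t t' H : ℝ} (ht : t ≤ 2)
    (htt : t' ≤ t)
    (h1 : H ≤ t * (s * ∑ j, Complex.normSq (((cplx P.C)ᵀ *ᵥ z) j)))
    (h2 : t' * (s * ∑ j, Complex.normSq (((cplx P.C)ᵀ *ᵥ z) j)) ≤ H) :
    (P.hMin t + P.phiMin * (1 - t)) * ∑ k, Complex.normSq (z k) ≤
      qf P.D z + 2 * s * ∑ j, Complex.normSq (((cplx P.C)ᵀ *ᵥ z) j) - H ∧
    qf P.D z + 2 * s * ∑ j, Complex.normSq (((cplx P.C)ᵀ *ᵥ z) j) - H ≤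
      (P.hMax t + P.phiMax * (1 - t')) * ∑ k, Complex.normSq (z k) := by
  have k1 := N.kappaMin_mul_le z
  have k2 := N.le_kappaMax_mul z
  have t1 := N.tauMin_mul_le z
  have t2 := N.le_tauMax_mul z
  have p1 := N.phiMin_mul_le z
  have p2 := N.le_phiMax_mul z
  set c2 := ∑ j, Complex.normSq (((cplx P.C)ᵀ *ᵥ z) j)
  set z2 := ∑ k, Complex.normSq (z k)
  unfold Data.hMin Data.hMax
  split_ifs with h
  · have q1 := mul_le_mul_of_nonneg_left p1 (show 0 ≤ 1 - t by linarith)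
    have q2 := mul_le_mul_of_nonneg_left p2 (show 0 ≤ 1 - t' by linarith)
    constructor <;> linarith
  · have q1 := mul_le_mul_of_nonneg_left p1 (show 0 ≤ 2 - t by linarith)
    by_cases h' : t' ≤ 2
    · have q2 := mul_le_mul_of_nonneg_left p2 (show 0 ≤ 2 - t' by linarith)
      constructor <;> linarith
    · exact absurd (htt.trans ht) h'

/-- Multiplying the weights of the form of `S` by factors in `[lo, hi]`. -/
theorem weighted_form_le (N : Normalized P a s) {I : Finset (Fin n)} {w : Fin n → ℝ} {hi : ℝ}
    (hhi : 0 ≤ hi) (hw : ∀ i ∈ I, a i * w i ≤ hi) (v : Fin n → ℂ) :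
    ∑ i ∈ I, w i * Complex.normSq (v i) ≤ hi * ∑ i, 1 / a i * Complex.normSq (v i) := by
  have h1 : ∑ i ∈ I, w i * Complex.normSq (v i) ≤
      ∑ i ∈ I, hi * (1 / a i * Complex.normSq (v i)) := by
    refine Finset.sum_le_sum fun i hI => ?_
    rw [← mul_assoc]
    refine mul_le_mul_of_nonneg_right ?_ (Complex.normSq_nonneg _)
    rw [mul_one_div, le_div_iff₀ (N.a_pos i), mul_comm]
    exact hw i hI
  refine h1.trans ?_
  rw [Finset.mul_sum]
  exact Finset.sum_le_sum_of_subset_of_nonneg (Finset.subset_univ _) fun i _ _ =>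
    mul_nonneg hhi (mul_nonneg (one_div_pos.mpr (N.a_pos i)).le (Complex.normSq_nonneg _))

theorem le_weighted_form (N : Normalized P a s) {w : Fin n → ℝ} {lo : ℝ}
    (hw : ∀ i, lo ≤ a i * w i) (v : Fin n → ℂ) :
    lo * ∑ i, 1 / a i * Complex.normSq (v i) ≤ ∑ i, w i * Complex.normSq (v i) := by
  rw [Finset.mul_sum]
  refine Finset.sum_le_sum fun i _ => ?_
  rw [← mul_assoc]
  refine mul_le_mul_of_nonneg_right ?_ (Complex.normSq_nonneg _)
  rw [mul_one_div, div_le_iff₀ (N.a_pos i), mul_comm]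
  exact hw i

theorem skew_nonneg (N : Normalized P a s) {T r₁ r₂ : ℝ} (hT : 0 ≤ T) :
    0 ≤ P.omegaMax - P.phiMax + P.phiMax * (T * P.varphiMax + varrho r₁ r₂) := by
  have h1 : 0 ≤ varrho r₁ r₂ := le_max_of_le_left (sq_nonneg _)
  have h2 := mul_nonneg N.phiMax_nonneg (add_nonneg (mul_nonneg hT N.varphiMax_nonneg) h1)
  have h3 := N.phiMax_le_omegaMax
  linarith

/-- The squared norm of the skew coupling of `z` with the other blocks. -/
theorem skew_bound (N : Normalized P a s) {e g : Fin n → ℝ} {J : Finset (Fin n)}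
    {T glo ghi : ℝ} (hT : 0 ≤ T) (hJ : ∀ i ∈ J, a i * e i ^ 2 ≤ T) (hglo : 0 ≤ glo)
    (hghi : 0 ≤ ghi) (hg : ∀ i, glo ≤ a i * g i ∧ a i * g i ≤ ghi) (z : Fin l → ℂ)
    {c : Fin m → ℂ} (hc : (cplx P.C)ᵀ *ᵥ z = c) {θ : Fin n → ℂ}
    (hθ : (cplx P.B)ᵀ *ᵥ (s : ℂ) • c = θ) :
    ∑ i ∈ J, Complex.normSq (e i * θ i) +
      ∑ j, Complex.normSq ((cplx P.B *ᵥ (fun i => g i * θ i) - c) j) ≤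
    (P.omegaMax - P.phiMax + P.phiMax *
      (T * P.varphiMax + varrho (ghi * P.varphiMax) (glo * P.varphiMin))) *
        ∑ k, Complex.normSq (z k) := by
  have hω := N.le_omegaMax_mul z
  have hφ := N.le_phiMax_mul z
  rw [hc] at hω hφ
  rcases N.s_eq with h0 | h0
  · have hθ0 : θ = 0 := by rw [← hθ, h0, Complex.ofReal_zero, zero_smul, mulVec_zero]
    rw [N.phiMax_eq_of_s_eq_zero h0]
    have e1 : (cplx P.B *ᵥ fun i => (g i : ℂ) * θ i) = 0 := by
      simp only [hθ0, Pi.zero_apply, mul_zero]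
      exact mulVec_zero _
    rw [e1]
    simpa [hθ0] using hω
  · have hθ1 : (cplx P.B)ᵀ *ᵥ c = θ := by rw [← hθ, h0, Complex.ofReal_one, one_smul]
    rw [h0, one_mul] at hφ
    have hS1 : ∀ u : Fin m → ℂ, P.varphiMin * ∑ j, Complex.normSq (u j) ≤
        ∑ i, 1 / a i * Complex.normSq (((cplx P.B)ᵀ *ᵥ u) i) := fun u => by
      have := N.varphiMin_mul_le u
      rwa [h0, one_mul, Complex.ofReal_one, one_smul] at this
    have hS2 : ∀ u : Fin m → ℂ, ∑ i, 1 / a i * Complex.normSq (((cplx P.B)ᵀ *ᵥ u) i) ≤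
        P.varphiMax * ∑ j, Complex.normSq (u j) := fun u => by
      have := N.le_varphiMax_mul u
      rwa [h0, one_mul, Complex.ofReal_one, one_smul] at this
    have b1 : ∑ i ∈ J, Complex.normSq (e i * θ i) ≤
        T * (P.varphiMax * ∑ j, Complex.normSq (c j)) := by
      have b2 := N.weighted_form_le hT hJ θ
      have b3 := mul_le_mul_of_nonneg_left (hS2 c) hT
      rw [hθ1] at b3
      refine (le_of_eq ?_).trans (b2.trans b3)
      refine Finset.sum_congr rfl fun i _ => ?_
      rw [Complex.normSq_mul, Complex.normSq_ofReal, sq]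
    -- For `s = 1` the vector is `(G - 1) c` with `G = B diag(g) Bᵀ`.
    set G := (P.Bᵀ)ᵀ * diagonal g * P.Bᵀ with hG
    have hGh : G.IsHermitian := by
      have : Gᵀ = G := by simp [hG, Matrix.mul_assoc]
      exact (conjTranspose_eq_transpose_of_trivial G).trans this
    have hq : ∀ u : Fin m → ℂ, qf (G - algebraMap ℝ _ 1) u =
        ∑ i, g i * Complex.normSq (((cplx P.B)ᵀ *ᵥ u) i) - ∑ j, Complex.normSq (u j) :=
      fun u => by
        rw [qf_sub, hG, qf_congr, qf_diagonal, qf_algebraMap, one_mul]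
        rfl
    have hH : (G - algebraMap ℝ (Matrix (Fin m) (Fin m) ℝ) 1).IsHermitian := by
      rw [map_one]
      exact hGh.sub isHermitian_one
    have b4 := sum_normSq_cplx_mulVec_le hH
      (lo := glo * P.varphiMin - 1) (hi := ghi * P.varphiMax - 1)
      (fun u => by
        rw [hq]
        have := N.le_weighted_form (fun i => (hg i).1) ((cplx P.B)ᵀ *ᵥ u)
        have := mul_le_mul_of_nonneg_left (hS1 u) hglo
        linarith)
      (fun u => by
        rw [hq]
        have := N.weighted_form_le hghi (fun i (_ : i ∈ Finset.univ) => (hg i).2)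
          ((cplx P.B)ᵀ *ᵥ u)
        have := mul_le_mul_of_nonneg_left (hS2 u) hghi
        linarith) c
    have b5 : cplx (G - algebraMap ℝ _ 1) *ᵥ c = cplx P.B *ᵥ (fun i => g i * θ i) - c := by
      have e1 : cplx (G - algebraMap ℝ (Matrix (Fin m) (Fin m) ℝ) 1) =
          cplx P.B * diagonal (fun i => (g i : ℂ)) * (cplx P.B)ᵀ - 1 := by
        ext i j
        simp [hG, Matrix.mul_apply, Matrix.one_apply, Matrix.diagonal_apply,
          apply_ite Complex.ofReal]
      rw [e1, sub_mulVec, one_mulVec, ← mulVec_mulVec, ← mulVec_mulVec, hθ1]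
      congr 2
      ext i
      rw [mulVec_diagonal]
    rw [b5] at b4
    have b6 : max ((ghi * P.varphiMax - 1) ^ 2) ((glo * P.varphiMin - 1) ^ 2) =
        varrho (ghi * P.varphiMax) (glo * P.varphiMin) := by
      rw [varrho, ← neg_sq (glo * P.varphiMin - 1), neg_sub]
    rw [b6] at b4
    have b7 : 0 ≤ T * P.varphiMax + varrho (ghi * P.varphiMax) (glo * P.varphiMin) :=
      add_nonneg (mul_nonneg hT N.varphiMax_nonneg) (le_max_of_le_left (sq_nonneg _))
    have b8 := mul_le_mul_of_nonneg_left hφ b7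
    rw [N.phiMax_eq_of_s_eq_one h0] at b8 ⊢
    linarith

end Normalized

/-! ### The three enclosures in normalized coordinates -/

theorem g₁_zero : g₁ 0 = 1 := by simp [g₁]

theorem g₂_zero : g₂ 0 = 1 := by simp [g₂]

namespace Normalized

variable {n m l : ℕ} {P : Data n m l} {a : Fin n → ℝ} {s : ℝ}

/-- `schur_bounds` for the middle matrix `B diag(w) Bᵀ`. -/
theorem schur_bounds_of_weights (N : Normalized P a s) {w : Fin n → ℝ} {lo hi : ℝ} (hlo : 0 ≤ lo)
    (hw : ∀ i, lo ≤ a i * w i ∧ a i * w i ≤ hi) (hhi : hi * P.varphiMax ≤ 2) (z : Fin l → ℂ)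
    {c : Fin m → ℂ} (hc : (cplx P.C)ᵀ *ᵥ z = c) {θ : Fin n → ℂ}
    (hθ : (cplx P.B)ᵀ *ᵥ (s : ℂ) • c = θ) :
    (P.hMin (hi * P.varphiMax) + P.phiMin * (1 - hi * P.varphiMax)) * ∑ k, Complex.normSq (z k) ≤
      qf P.D z + 2 * s * ∑ j, Complex.normSq (c j) - ∑ i, w i * Complex.normSq (θ i) ∧
    qf P.D z + 2 * s * ∑ j, Complex.normSq (c j) - ∑ i, w i * Complex.normSq (θ i) ≤
      (P.hMax (hi * P.varphiMax) + P.phiMax * (1 - lo * P.varphiMin)) *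
        ∑ k, Complex.normSq (z k) := by
  have hle : lo ≤ hi := (hw ⟨0, N.n_pos⟩).1.trans (hw _).2
  have hhi0 : 0 ≤ hi := hlo.trans hle
  have h1 := N.weighted_form_le hhi0 (fun i (_ : i ∈ Finset.univ) => (hw i).2) θ
  have h2 := N.le_weighted_form (fun i => (hw i).1) θ
  have h3 := mul_le_mul_of_nonneg_left (N.le_varphiMax_mul c) hhi0
  have h4 := mul_le_mul_of_nonneg_left (N.varphiMin_mul_le c) hlo
  rw [hθ] at h3 h4
  have h5 := N.schur_bounds z (t := hi * P.varphiMax) (t' := lo * P.varphiMin)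
    (H := ∑ i, w i * Complex.normSq (θ i)) hhi
    (mul_le_mul hle N.varphiMin_le_varphiMax N.varphiMin_nonneg hhi0)
    (by rw [hc]; linarith) (by rw [hc]; linarith)
  rwa [hc] at h5

theorem nu_bounds_of_weights (N : Normalized P a s) {w : Fin n → ℝ} {lo hi : ℝ} (hlo : 0 ≤ lo)
    (hw : ∀ i, lo ≤ a i * w i ∧ a i * w i ≤ hi) {y : Fin m → ℂ} {β : Fin n → ℂ}
    (hβ : (cplx P.B)ᵀ *ᵥ y = β) :
    lo * P.nuMin * ∑ j, Complex.normSq (y j) ≤ ∑ i, w i * Complex.normSq (β i) ∧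
    ∑ i, w i * Complex.normSq (β i) ≤ hi * P.nuMax * ∑ j, Complex.normSq (y j) := by
  have hle : lo ≤ hi := (hw ⟨0, N.n_pos⟩).1.trans (hw _).2
  have hhi0 : 0 ≤ hi := hlo.trans hle
  have h1 := N.weighted_form_le hhi0 (fun i (_ : i ∈ Finset.univ) => (hw i).2) β
  have h2 := N.le_weighted_form (fun i => (hw i).1) β
  have h3 := mul_le_mul_of_nonneg_left (N.le_nuMax_mul y) hhi0
  have h4 := mul_le_mul_of_nonneg_left (N.nuMin_mul_le y) hlo
  rw [hβ] at h3 h4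
  constructor <;> linarith

/-- Bound for the squared norm of `diag(r) Bᵀ y` restricted to `J`. -/
theorem sum_normSq_mul_le_nu (N : Normalized P a s) {r : Fin n → ℝ} {J : Finset (Fin n)} {K : ℝ}
    (hK : 0 ≤ K) (hr : ∀ i ∈ J, a i * r i ^ 2 ≤ K) {y : Fin m → ℂ} {β : Fin n → ℂ}
    (hβ : (cplx P.B)ᵀ *ᵥ y = β) :
    ∑ i ∈ J, Complex.normSq (r i * β i) ≤ P.nuMax * K * ∑ j, Complex.normSq (y j) := by
  have h1 := N.weighted_form_le hK hr β
  have h3 := mul_le_mul_of_nonneg_left (N.le_nuMax_mul y) hK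
  rw [hβ] at h3
  have h4 : ∑ i ∈ J, Complex.normSq (r i * β i) = ∑ i ∈ J, r i ^ 2 * Complex.normSq (β i) :=
    Finset.sum_congr rfl fun i _ => by rw [Complex.normSq_mul, Complex.normSq_ofReal, sq]
  rw [h4]
  linarith

/-- Bound for the squared norm of `diag(r) Bᵀ W_S Cᵀ z` restricted to `J`. -/
theorem sum_normSq_mul_le_phi (N : Normalized P a s) {r : Fin n → ℝ} {J : Finset (Fin n)} {K : ℝ}
    (hK : 0 ≤ K) (hr : ∀ i ∈ J, a i * r i ^ 2 ≤ K) (z : Fin l → ℂ)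
    {c : Fin m → ℂ} (hc : (cplx P.C)ᵀ *ᵥ z = c) {θ : Fin n → ℂ}
    (hθ : (cplx P.B)ᵀ *ᵥ (s : ℂ) • c = θ) :
    ∑ i ∈ J, Complex.normSq (r i * θ i) ≤
      P.phiMax * P.varphiMax * K * ∑ k, Complex.normSq (z k) := by
  have h1 := N.weighted_form_le hK hr θ
  have h2 := N.le_varphiMax_mul c
  have h3 := mul_le_mul_of_nonneg_left (N.le_phiMax_mul z) N.varphiMax_nonneg
  rw [hθ] at h2
  rw [hc] at h3
  have h5 := mul_le_mul_of_nonneg_left (h2.trans h3) hK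
  have h4 : ∑ i ∈ J, Complex.normSq (r i * θ i) = ∑ i ∈ J, r i ^ 2 * Complex.normSq (θ i) :=
    Finset.sum_congr rfl fun i _ => by rw [Complex.normSq_mul, Complex.normSq_ofReal, sq]
  rw [h4]
  linarith

theorem xiHat_nonneg (N : Normalized P a s) (h : P.gammaMin ≤ 1) : 0 ≤ P.xiHat :=
  div_nonneg (mul_nonneg (mul_nonneg N.phiMax_nonneg N.varphiMax_nonneg) (sub_nonneg.mpr h))
    N.muMin_pos.le

theorem xiHat_eq (P : Data n m l) :
    P.xiHat = P.phiMax * P.varphiMax * ((1 - P.gammaMin) / P.muMin) := by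
  rw [Data.xiHat, mul_div_assoc]

theorem xiOne_eq (P : Data n m l) : P.xiOne = P.nuMax * (1 - 1 / P.muMax) := by
  rw [Data.xiOne]
  ring

theorem nuMax_nonneg (N : Normalized P a s) : 0 ≤ P.nuMax :=
  N.nuMin_nonneg.trans N.nuMin_le_nuMax

theorem one_sub_inv_nonneg {t : ℝ} (h : 1 ≤ t) : 0 ≤ 1 - 1 / t := by
  rw [sub_nonneg, div_le_one (by linarith)]
  exact h

theorem xiOne_nonneg (N : Normalized P a s) (h : 1 ≤ P.muMax) : 0 ≤ P.xiOne := by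
  rw [xiOne_eq]
  exact mul_nonneg N.nuMax_nonneg (one_sub_inv_nonneg h)

theorem muMax_nonneg (N : Normalized P a s) : 0 ≤ P.muMax :=
  N.muMin_pos.le.trans N.muMin_le_muMax

/-- This and the next five lemmas: the interval of the real part contains the eigenvalues of
`M_A⁻¹A`. -/
theorem etaMin₁_le (N : Normalized P a s) (h : P.gammaMin ≤ 1) : P.etaMin₁ ≤ P.muMin := by
  have hξ := N.xiHat_nonneg h
  have h1 := mul_le_mul_of_nonneg_right (min_le_left P.muMin
    (min (P.hMin P.varphiMax + P.phiMin * (1 - P.varphiMax))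
      (P.gammaMin * P.nuMin / g₁ P.xiHat))) (g₁_pos hξ).le
  have h2 := mul_le_mul_of_nonneg_left (g₁_le_one hξ) N.muMin_pos.le
  unfold Data.etaMin₁
  linarith

theorem le_etaMax₁ (N : Normalized P a s) (h : P.gammaMin ≤ 1) : P.muMax ≤ P.etaMax₁ := by
  have hξ := N.xiHat_nonneg h
  have h1 := mul_le_mul_of_nonneg_right (le_max_left P.muMax
    (max (P.hMax P.varphiMax + P.phiMax * (1 - P.varphiMin))
      (P.gammaMax * P.nuMax / g₂ P.xiHat))) (zero_le_one.trans (one_le_g₂ hξ))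
  have h2 := mul_le_mul_of_nonneg_left (one_le_g₂ hξ) N.muMax_nonneg
  unfold Data.etaMax₁
  linarith

theorem etaMin₂_le (N : Normalized P a s) (h : 1 ≤ P.muMax) : P.etaMin₂ ≤ P.muMin := by
  have hξ := N.xiOne_nonneg h
  have h2 := mul_le_mul_of_nonneg_left (g₁_le_one hξ) N.muMin_pos.le
  exact (min_le_left _ _).trans (by linarith)

theorem le_etaMax₂ (N : Normalized P a s) (h : 1 ≤ P.muMax) : P.muMax ≤ P.etaMax₂ := by
  have hξ := N.xiOne_nonneg h
  have h2 := mul_le_mul_of_nonneg_left (one_le_g₂ hξ) N.muMax_nonneg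
  exact le_trans (by linarith) (le_max_left _ _)

theorem etaMin₃_le (N : Normalized P a s) (h : P.gammaMin ≤ 1) : P.etaMin₃ ≤ P.muMin := by
  have hξ := N.xiHat_nonneg h
  have h2 := mul_le_mul_of_nonneg_left (g₁_le_one hξ) N.muMin_pos.le
  exact (mul_le_mul_of_nonneg_right (min_le_left _ _) (g₁_pos hξ).le).trans (by linarith)

theorem le_etaMax₃ (N : Normalized P a s) (h : P.gammaMin ≤ 1) (h' : 1 ≤ P.muMax) :
    P.muMax ≤ P.etaMax₃ := by
  have hξ := N.xiHat_nonneg h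
  have hg := zero_lt_one.trans_le (one_le_g₂ hξ)
  have h2 := mul_le_mul_of_nonneg_left (one_le_g₂ (N.xiOne_nonneg h')) N.muMax_nonneg
  have h3 : P.muMax * g₂ P.xiOne ≤ P.etaMax₃ := by
    have h4 := mul_le_mul_of_nonneg_right
      (((le_max_left (P.muMax * g₂ P.xiOne / g₂ P.xiHat)
        (P.nuMax * g₂ P.xiOne / g₂ P.xiHat)).trans (le_max_right
          (P.hMax (P.muMax * P.varphiMax) + P.phiMax * (1 - P.varphiMin)) _)).trans
            (le_max_right 1 _)) hg.le
    rwa [div_mul_cancel₀ _ hg.ne'] at h4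
  linarith

/-- The case of a nonnegative `(I - Y_A A)(I - Z_A A)`. -/
theorem bounds₁ (N : Normalized P a s) {e g : Fin n → ℝ} {lam : ℂ}
    {x : Fin n → ℂ} {y : Fin m → ℂ} {z : Fin l → ℂ}
    (h : ReducedEigen a e g Finset.univ s P.B P.C P.D lam x y z)
    (hN : 0 < ∑ i, Complex.normSq (x i) + ∑ j, Complex.normSq (y j) +
        ∑ k, Complex.normSq (z k))
    (hg : ∀ i, a i * g i = 1 - e i ^ 2) (hnu : P.nuMax ≤ 2)
    (hγ : ∀ i, P.gammaMin ≤ a i * g i ∧ a i * g i ≤ P.gammaMax) (hγ₀ : 0 ≤ P.gammaMin)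
    (hγ₁ : P.gammaMax ≤ 1)
    (hL : ∀ i, a i * e i ^ 2 ≤ lamMax ((1 - P.YA * P.A) * (1 - P.ZA * P.A) * P.MA⁻¹ * P.A)) :
    P.etaMin₁ ≤ lam.re ∧ lam.re ≤ P.etaMax₁ ∧ |lam.im| ≤ P.rho₁ := by
  have hγle : P.gammaMin ≤ P.gammaMax := (hγ ⟨0, N.n_pos⟩).1.trans (hγ _).2
  have hξ := N.xiHat_nonneg (hγle.trans hγ₁)
  have hp1 := g₁_pos hξ
  have hp2 := zero_lt_one.trans_le (one_le_g₂ hξ)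
  have hϕ2 : P.varphiMax ≤ 2 := N.varphiMax_le_nuMax.trans hnu
  have hR := N.schur_bounds_of_weights (w := fun i => if i ∈ Finset.univ then 1 / a i else g i)
    (lo := 1) (hi := 1) zero_le_one (fun i => by simp [(N.a_pos i).ne'])
    (by rwa [one_mul]) z rfl rfl
  simp only [one_mul] at hR
  have hK := N.nu_bounds_of_weights (w := fun i => if i ∈ Finset.univ then g i else 1 / a i)
    hγ₀ (fun i => by simpa using hγ i) (y := y) rfl
  have hu := N.sum_normSq_mul_le_phi (r := fun i => e i / a i) (J := Finset.univ)
    (K := (1 - P.gammaMin) / P.muMin)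
    (div_nonneg (sub_nonneg.mpr (hγle.trans hγ₁)) N.muMin_pos.le)
    (fun i _ => by
      have h1 : a i * (e i / a i) ^ 2 = e i ^ 2 / a i := by
        have := (N.a_pos i).ne'
        field_simp
      rw [h1]
      exact div_le_div₀ (sub_nonneg.mpr (hγle.trans hγ₁)) (by linarith [hg i, (hγ i).1])
        N.muMin_pos (N.muMin_le i)) z rfl rfl
  rw [← xiHat_eq] at hu
  have hL0 := (mul_nonneg (N.a_pos ⟨0, N.n_pos⟩).le (sq_nonneg _)).trans (hL ⟨0, N.n_pos⟩)
  have hre := h.re_bounds rfl rfl rfl N.a_pos (fun i => by simpa using hg i) hN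
    (m₁ := min P.muMin (P.hMin P.varphiMax + P.phiMin * (1 - P.varphiMax)))
    (M₁ := max P.muMax (P.hMax P.varphiMax + P.phiMax * (1 - P.varphiMin)))
    -- No index lies off `univ`, so `m₂`, `M₂` bound only the form in `y`, and `ξ₂ = 0`.
    (m₂ := P.gammaMin * P.nuMin) (M₂ := P.gammaMax * P.nuMax)
    (lo := P.etaMin₁) (hi := P.etaMax₁) hξ le_rfl
    (le_min N.muMin_pos.le (N.hMin_add_nonneg hϕ2)) (le_max_of_le_left N.muMax_nonneg)
    (mul_nonneg hγ₀ N.nuMin_nonneg) (mul_nonneg (hγ₀.trans hγle) N.nuMax_nonneg)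
    (fun i _ => ⟨(min_le_left _ _).trans (N.muMin_le i), (N.le_muMax i).trans (le_max_left _ _)⟩)
    (fun i hi => absurd (Finset.mem_univ i) hi)
    ((mul_le_mul_of_nonneg_right (min_le_right _ _) (sum_normSq_nonneg _ z)).trans hR.1)
    (hR.2.trans (mul_le_mul_of_nonneg_right (le_max_right _ _) (sum_normSq_nonneg _ z)))
    hK.1 hK.2 hu
    (by simp)
    (mul_le_mul_of_nonneg_right (min_le_min_left _ (min_le_left _ _)) hp1.le)
    (by
      refine (mul_le_mul_of_nonneg_right ((min_le_right _ _).trans (min_le_right _ _))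
        hp1.le).trans_eq ?_
      rw [div_mul_cancel₀ _ hp1.ne', g₁_zero, mul_one])
    (mul_le_mul_of_nonneg_right (max_le_max_left _ (le_max_left _ _)) hp2.le)
    (by
      refine le_trans (le_of_eq ?_) (mul_le_mul_of_nonneg_right
        ((le_max_right _ _).trans (le_max_right _ _)) hp2.le)
      rw [div_mul_cancel₀ _ hp2.ne', g₂_zero, mul_one])
  have hP0 := N.skew_nonneg (T := 0) (r₁ := P.gammaMax * P.varphiMax)
    (r₂ := P.gammaMin * P.varphiMin) le_rfl
  have hsk := N.skew_bound (e := e) (J := Finset.univᶜ) (T := 0) le_rfl (fun i hi => by simp at hi)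
    hγ₀ (hγ₀.trans hγle) hγ z rfl rfl
  rw [zero_mul, zero_add] at hP0 hsk
  exact ⟨hre.1, hre.2, h.abs_im_le N.D_psd.1 rfl rfl rfl hN hP0 (mul_nonneg N.nuMax_nonneg hL0)
    (N.sum_normSq_mul_le_nu hL0 (fun i _ => hL i) rfl) hsk⟩

/-- The case of a nonpositive `(I - Y_A A)(I - Z_A A)`. -/
theorem bounds₂ (N : Normalized P a s) {e g : Fin n → ℝ} {lam : ℂ}
    {x : Fin n → ℂ} {y : Fin m → ℂ} {z : Fin l → ℂ}
    (h : ReducedEigen a e g ∅ s P.B P.C P.D lam x y z)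
    (hN : 0 < ∑ i, Complex.normSq (x i) + ∑ j, Complex.normSq (y j) +
        ∑ k, Complex.normSq (z k))
    (hg : ∀ i, g i = 1) (he : ∀ i, e i ^ 2 = a i - 1) (hmunu : P.muMax * P.nuMax ≤ 2) :
    P.etaMin₂ ≤ lam.re ∧ lam.re ≤ P.etaMax₂ ∧ |lam.im| ≤ P.rho₂ := by
  have ha1 : ∀ i, 1 ≤ a i := fun i => by linarith [he i, sq_nonneg (e i)]
  have hmu1 : 1 ≤ P.muMax := (ha1 ⟨0, N.n_pos⟩).trans (N.le_muMax _)
  have hξ := N.xiOne_nonneg hmu1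
  have hp1 := g₁_pos hξ
  have hp2 := zero_lt_one.trans_le (one_le_g₂ hξ)
  have hϕ2 : P.muMax * P.varphiMax ≤ 2 :=
    (mul_le_mul_of_nonneg_left N.varphiMax_le_nuMax N.muMax_nonneg).trans hmunu
  have hag : ∀ i, P.muMin ≤ a i * g i ∧ a i * g i ≤ P.muMax := fun i => by
    rw [hg, mul_one]
    exact ⟨N.muMin_le i, N.le_muMax i⟩
  have hR := N.schur_bounds_of_weights (w := fun i => if i ∈ (∅ : Finset (Fin n)) then 1 / a i
    else g i) N.muMin_pos.le (fun i => by simpa using hag i) hϕ2 z rfl rfl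
  have hK := N.nu_bounds_of_weights (w := fun i => if i ∈ (∅ : Finset (Fin n)) then g i
    else 1 / a i) (lo := 1) (hi := 1) zero_le_one (fun i => by simp [(N.a_pos i).ne']) (y := y) rfl
  simp only [one_mul] at hK
  have hu := N.sum_normSq_mul_le_nu (r := fun i => e i / a i) (J := ∅ᶜ)
    (K := 1 - 1 / P.muMax) (one_sub_inv_nonneg hmu1)
    (fun i _ => by
      have h1 : a i * (e i / a i) ^ 2 = 1 - 1 / a i := by
        have := (N.a_pos i).ne'
        rw [div_pow, he]
        field_simp
      rw [h1]
      exact sub_le_sub_left (one_div_le_one_div_of_le (N.a_pos i) (N.le_muMax i)) _)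
    (y := y) rfl
  rw [← xiOne_eq] at hu
  have hhi : P.muMax * g₂ P.xiOne ≤ P.etaMax₂ := le_max_left _ _
  have hre := h.re_bounds rfl rfl rfl N.a_pos (fun i => by simp [hg, he]) hN
    (m₁ := P.hMin (P.muMax * P.varphiMax) + P.phiMin * (1 - P.muMax * P.varphiMax))
    -- The maximum with `0` only serves the sign condition on `M₁`.
    (M₁ := max 0 (P.hMax (P.muMax * P.varphiMax) + P.phiMax * (1 - P.muMin * P.varphiMin)))
    (m₂ := min P.muMin P.nuMin) (M₂ := max P.muMax P.nuMax)
    (lo := P.etaMin₂) (hi := P.etaMax₂) le_rfl hξ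
    (N.hMin_add_nonneg hϕ2) (le_max_left _ _)
    (le_min N.muMin_pos.le N.nuMin_nonneg) (le_max_of_le_left N.muMax_nonneg)
    (fun i hi => absurd hi (Finset.notMem_empty i))
    (fun i _ => ⟨(min_le_left _ _).trans (N.muMin_le i), (N.le_muMax i).trans (le_max_left _ _)⟩)
    hR.1
    (hR.2.trans (mul_le_mul_of_nonneg_right (le_max_right _ _) (sum_normSq_nonneg _ z)))
    ((mul_le_mul_of_nonneg_right (min_le_right _ _) (sum_normSq_nonneg _ y)).trans hK.1)
    (hK.2.trans (mul_le_mul_of_nonneg_right (le_max_right _ _) (sum_normSq_nonneg _ y)))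
    (by simp)
    hu
    (by
      rw [g₁_zero, mul_one]
      exact (min_le_right _ _).trans (min_le_right _ _))
    (by
      rw [min_mul_of_nonneg _ _ hp1.le]
      exact min_le_min_left _ (min_le_left _ _))
    (by
      rw [g₂_zero, mul_one]
      refine max_le ((mul_nonneg N.muMax_nonneg hp2.le).trans hhi) ?_
      exact (le_max_right _ _).trans (le_max_right _ _))
    (by
      rw [max_mul_of_nonneg _ _ hp2.le]
      exact max_le_max_left _ (le_max_left _ _))
  have hT : 0 ≤ (P.muMax - 1) * P.muMax := mul_nonneg (sub_nonneg.mpr hmu1) N.muMax_nonneg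
  have hP0 := N.skew_nonneg (r₁ := P.muMax * P.varphiMax) (r₂ := P.muMin * P.varphiMin) hT
  have hsk := N.skew_bound (e := e) (J := ∅ᶜ) hT (fun i _ => by
      rw [he, mul_comm]
      exact mul_le_mul (sub_le_sub_right (N.le_muMax i) _) (N.le_muMax i) (N.a_pos i).le
        (sub_nonneg.mpr hmu1))
    N.muMin_pos.le N.muMax_nonneg hag z rfl rfl
  have him := h.abs_im_le N.D_psd.1 rfl rfl rfl hN hP0 le_rfl (by simp) hsk
  rw [add_zero] at him
  exact ⟨hre.1, hre.2, him⟩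

/-- The case of an indefinite `(I - Y_A A)(I - Z_A A)`, where exactly one of `Y_A`, `Z_A` is
nonzero. -/
theorem bounds₃ (N : Normalized P a s) {e g : Fin n → ℝ} {I : Finset (Fin n)} {lam : ℂ}
    {x : Fin n → ℂ} {y : Fin m → ℂ} {z : Fin l → ℂ}
    (h : ReducedEigen a e g I s P.B P.C P.D lam x y z)
    (hN : 0 < ∑ i, Complex.normSq (x i) + ∑ j, Complex.normSq (y j) +
        ∑ k, Complex.normSq (z k))
    (hI : ∀ i, i ∈ I ↔ a i ≤ 1) (hg : ∀ i, g i = 1) (he : ∀ i, e i ^ 2 = |1 - a i|)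
    (hmunu : P.muMax * P.nuMax ≤ 2) (hmu₀ : P.muMin ≤ 1) (hmu₁ : 1 ≤ P.muMax)
    (hγ : P.gammaMin = P.muMin) (hL₀ : 0 ≤ lamMax (P.MA⁻¹ * P.A * (1 - P.MA⁻¹ * P.A)))
    (hL : ∀ i, a i * (1 - a i) ≤ lamMax (P.MA⁻¹ * P.A * (1 - P.MA⁻¹ * P.A))) :
    P.etaMin₃ ≤ lam.re ∧ lam.re ≤ P.etaMax₃ ∧ |lam.im| ≤ P.rho₃ := by
  have he1 : ∀ i ∈ I, e i ^ 2 = 1 - a i := fun i hi => by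
    rw [he, abs_of_nonneg (sub_nonneg.mpr ((hI i).mp hi))]
  have ha2 : ∀ i, i ∉ I → 1 ≤ a i := fun i hi => (not_le.mp (mt (hI i).mpr hi)).le
  have he2 : ∀ i, i ∉ I → e i ^ 2 = a i - 1 := fun i hi => by
    rw [he, abs_of_nonpos (sub_nonpos.mpr (ha2 i hi)), neg_sub]
  have hξ₁ := N.xiHat_nonneg (hγ.trans_le hmu₀)
  have hξ₂ := N.xiOne_nonneg hmu₁
  have hp1 := g₁_pos hξ₁
  have hp2 := zero_lt_one.trans_le (one_le_g₂ hξ₁)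
  have hq1 := g₁_pos hξ₂
  have hq2 := zero_lt_one.trans_le (one_le_g₂ hξ₂)
  have hϕ2 : P.muMax * P.varphiMax ≤ 2 :=
    (mul_le_mul_of_nonneg_left N.varphiMax_le_nuMax N.muMax_nonneg).trans hmunu
  have hag : ∀ i, P.muMin ≤ a i * g i ∧ a i * g i ≤ P.muMax := fun i => by
    rw [hg, mul_one]
    exact ⟨N.muMin_le i, N.le_muMax i⟩
  have hR := N.schur_bounds_of_weights (w := fun i => if i ∈ I then 1 / a i else g i)
    (lo := 1) (hi := P.muMax) zero_le_one (fun i => by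
      by_cases hi : i ∈ I
      · simp [hi, (N.a_pos i).ne', hmu₁]
      · simpa [hi, hg] using ⟨ha2 i hi, N.le_muMax i⟩) hϕ2 z rfl rfl
  rw [one_mul] at hR
  have hK := N.nu_bounds_of_weights (w := fun i => if i ∈ I then g i else 1 / a i)
    (lo := P.muMin) (hi := 1) N.muMin_pos.le (fun i => by
      by_cases hi : i ∈ I
      · simpa [hi, hg] using ⟨N.muMin_le i, (hI i).mp hi⟩
      · simp [hi, (N.a_pos i).ne', hmu₀]) (y := y) rfl
  rw [one_mul] at hK
  have hu₁ := N.sum_normSq_mul_le_phi (r := fun i => e i / a i) (J := I)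
    (K := (1 - P.gammaMin) / P.muMin)
    (div_nonneg (sub_nonneg.mpr (hγ.trans_le hmu₀)) N.muMin_pos.le)
    (fun i hi => by
      have h1 : a i * (e i / a i) ^ 2 = e i ^ 2 / a i := by
        have := (N.a_pos i).ne'
        field_simp
      rw [h1, he1 i hi, hγ]
      exact div_le_div₀ (sub_nonneg.mpr hmu₀) (sub_le_sub_left (N.muMin_le i) _)
        N.muMin_pos (N.muMin_le i)) z rfl rfl
  rw [← xiHat_eq] at hu₁
  have hu₂ := N.sum_normSq_mul_le_nu (r := fun i => e i / a i) (J := Iᶜ)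
    (K := 1 - 1 / P.muMax) (one_sub_inv_nonneg hmu₁)
    (fun i hi => by
      have h1 : a i * (e i / a i) ^ 2 = 1 - 1 / a i := by
        have := (N.a_pos i).ne'
        rw [div_pow, he2 i (Finset.mem_compl.mp hi)]
        field_simp
      rw [h1]
      exact sub_le_sub_left (one_div_le_one_div_of_le (N.a_pos i) (N.le_muMax i)) _)
    (y := y) rfl
  rw [← xiOne_eq] at hu₂
  have hre := h.re_bounds rfl rfl rfl N.a_pos (fun i => by
      by_cases hi : i ∈ I
      · rw [hg, if_pos hi, he1 i hi]
        ring
      · rw [hg, if_neg hi, he2 i hi]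
        ring) hN
    (m₁ := min P.muMin (P.hMin (P.muMax * P.varphiMax) + P.phiMin * (1 - P.muMax * P.varphiMax)))
    (M₁ := max 1 (P.hMax (P.muMax * P.varphiMax) + P.phiMax * (1 - P.varphiMin)))
    (m₂ := min 1 (P.muMin * P.nuMin)) (M₂ := max P.muMax P.nuMax)
    (lo := P.etaMin₃) (hi := P.etaMax₃) hξ₁ hξ₂
    (le_min N.muMin_pos.le (N.hMin_add_nonneg hϕ2)) (le_max_of_le_left zero_le_one)
    (le_min zero_le_one (mul_nonneg N.muMin_pos.le N.nuMin_nonneg))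
    (le_max_of_le_left N.muMax_nonneg)
    (fun i hi => ⟨(min_le_left _ _).trans (N.muMin_le i),
      ((hI i).mp hi).trans (le_max_left _ _)⟩)
    (fun i hi => ⟨(min_le_left _ _).trans (ha2 i hi), (N.le_muMax i).trans (le_max_left _ _)⟩)
    ((mul_le_mul_of_nonneg_right (min_le_right _ _) (sum_normSq_nonneg _ z)).trans hR.1)
    (hR.2.trans (mul_le_mul_of_nonneg_right (le_max_right _ _) (sum_normSq_nonneg _ z)))
    ((mul_le_mul_of_nonneg_right (min_le_right _ _) (sum_normSq_nonneg _ y)).trans hK.1)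
    (hK.2.trans (mul_le_mul_of_nonneg_right (le_max_right _ _) (sum_normSq_nonneg _ y)))
    hu₁ hu₂
    (mul_le_mul_of_nonneg_right (min_le_min_left _ (min_le_left _ _)) hp1.le)
    (by
      refine (mul_le_mul_of_nonneg_right ((min_le_right _ _).trans (min_le_right _ _))
        hp1.le).trans_eq ?_
      rw [min_mul_of_nonneg _ _ hp1.le, min_mul_of_nonneg _ _ hq1.le, div_mul_cancel₀ _ hp1.ne',
        div_mul_cancel₀ _ hp1.ne', one_mul])
    (mul_le_mul_of_nonneg_right (max_le_max_left _ (le_max_left _ _)) hp2.le)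
    (by
      refine le_trans (le_of_eq ?_) (mul_le_mul_of_nonneg_right
        ((le_max_right _ _).trans (le_max_right _ _)) hp2.le)
      rw [max_mul_of_nonneg _ _ hp2.le, max_mul_of_nonneg _ _ hq2.le, div_mul_cancel₀ _ hp2.ne',
        div_mul_cancel₀ _ hp2.ne'])
  have hT : 0 ≤ (P.muMax - 1) * P.muMax := mul_nonneg (sub_nonneg.mpr hmu₁) N.muMax_nonneg
  have hP0 := N.skew_nonneg (r₁ := P.muMax * P.varphiMax) (r₂ := P.muMin * P.varphiMin) hT
  have hsk := N.skew_bound (e := e) (J := Iᶜ) hT (fun i hi => by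
      rw [he2 i (Finset.mem_compl.mp hi), mul_comm]
      exact mul_le_mul (sub_le_sub_right (N.le_muMax i) _) (N.le_muMax i) (N.a_pos i).le
        (sub_nonneg.mpr hmu₁))
    N.muMin_pos.le N.muMax_nonneg hag z rfl rfl
  exact ⟨hre.1, hre.2, h.abs_im_le N.D_psd.1 rfl rfl rfl hN hP0 (mul_nonneg N.nuMax_nonneg hL₀)
    (N.sum_normSq_mul_le_nu hL₀ (fun i hi => by rw [he1 i hi]; exact hL i) rfl) hsk⟩

end Normalized

/-! ### From the block matrices to the reduced equations -/

theorem cplx_mul {ι κ τ : Type*} [Fintype κ] (X : Matrix ι κ ℝ) (Y : Matrix κ τ ℝ) :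
    cplx (X * Y) = cplx X * cplx Y :=
  Matrix.map_mul (f := Complex.ofRealHom)

theorem cplx_block3_mulVec {n m l : ℕ}
    (T₁₁ : Matrix (Fin n) (Fin n) ℝ) (T₁₂ : Matrix (Fin n) (Fin m) ℝ)
    (T₁₃ : Matrix (Fin n) (Fin l) ℝ)
    (T₂₁ : Matrix (Fin m) (Fin n) ℝ) (T₂₂ : Matrix (Fin m) (Fin m) ℝ)
    (T₂₃ : Matrix (Fin m) (Fin l) ℝ)
    (T₃₁ : Matrix (Fin l) (Fin n) ℝ) (T₃₂ : Matrix (Fin l) (Fin m) ℝ)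
    (T₃₃ : Matrix (Fin l) (Fin l) ℝ) (v₁ : Fin n → ℂ) (v₂ : Fin m → ℂ) (v₃ : Fin l → ℂ) :
    cplx (block3 T₁₁ T₁₂ T₁₃ T₂₁ T₂₂ T₂₃ T₃₁ T₃₂ T₃₃) *ᵥ Sum.elim v₁ (Sum.elim v₂ v₃) =
      Sum.elim (cplx T₁₁ *ᵥ v₁ + cplx T₁₂ *ᵥ v₂ + cplx T₁₃ *ᵥ v₃)
        (Sum.elim (cplx T₂₁ *ᵥ v₁ + cplx T₂₂ *ᵥ v₂ + cplx T₂₃ *ᵥ v₃)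
          (cplx T₃₁ *ᵥ v₁ + cplx T₃₂ *ᵥ v₂ + cplx T₃₃ *ᵥ v₃)) := by
  ext (i | i | i) <;>
    simp [block3, mulVec, dotProduct, Fintype.sum_sum_type, add_assoc]

theorem block3_mul {n m l : ℕ}
    (T₁₁ S₁₁ : Matrix (Fin n) (Fin n) ℝ) (T₁₂ S₁₂ : Matrix (Fin n) (Fin m) ℝ)
    (T₁₃ S₁₃ : Matrix (Fin n) (Fin l) ℝ)
    (T₂₁ S₂₁ : Matrix (Fin m) (Fin n) ℝ) (T₂₂ S₂₂ : Matrix (Fin m) (Fin m) ℝ)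
    (T₂₃ S₂₃ : Matrix (Fin m) (Fin l) ℝ)
    (T₃₁ S₃₁ : Matrix (Fin l) (Fin n) ℝ) (T₃₂ S₃₂ : Matrix (Fin l) (Fin m) ℝ)
    (T₃₃ S₃₃ : Matrix (Fin l) (Fin l) ℝ) :
    block3 T₁₁ T₁₂ T₁₃ T₂₁ T₂₂ T₂₃ T₃₁ T₃₂ T₃₃ * block3 S₁₁ S₁₂ S₁₃ S₂₁ S₂₂ S₂₃ S₃₁ S₃₂ S₃₃ =
      block3
        (T₁₁ * S₁₁ + T₁₂ * S₂₁ + T₁₃ * S₃₁) (T₁₁ * S₁₂ + T₁₂ * S₂₂ + T₁₃ * S₃₂)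
        (T₁₁ * S₁₃ + T₁₂ * S₂₃ + T₁₃ * S₃₃)
        (T₂₁ * S₁₁ + T₂₂ * S₂₁ + T₂₃ * S₃₁) (T₂₁ * S₁₂ + T₂₂ * S₂₂ + T₂₃ * S₃₂)
        (T₂₁ * S₁₃ + T₂₂ * S₂₃ + T₂₃ * S₃₃)
        (T₃₁ * S₁₁ + T₃₂ * S₂₁ + T₃₃ * S₃₁) (T₃₁ * S₁₂ + T₃₂ * S₂₂ + T₃₃ * S₃₂)
        (T₃₁ * S₁₃ + T₃₂ * S₂₃ + T₃₃ * S₃₃) := by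
  ext (i | i | i) (j | j | j) <;>
    simp [block3, Matrix.mul_apply, Fintype.sum_sum_type, add_assoc]

theorem block3_transpose {n m l : ℕ}
    (T₁₁ : Matrix (Fin n) (Fin n) ℝ) (T₁₂ : Matrix (Fin n) (Fin m) ℝ)
    (T₁₃ : Matrix (Fin n) (Fin l) ℝ)
    (T₂₁ : Matrix (Fin m) (Fin n) ℝ) (T₂₂ : Matrix (Fin m) (Fin m) ℝ)
    (T₂₃ : Matrix (Fin m) (Fin l) ℝ)
    (T₃₁ : Matrix (Fin l) (Fin n) ℝ) (T₃₂ : Matrix (Fin l) (Fin m) ℝ)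
    (T₃₃ : Matrix (Fin l) (Fin l) ℝ) :
    (block3 T₁₁ T₁₂ T₁₃ T₂₁ T₂₂ T₂₃ T₃₁ T₃₂ T₃₃)ᵀ =
      block3 T₁₁ᵀ T₂₁ᵀ T₃₁ᵀ T₁₂ᵀ T₂₂ᵀ T₃₂ᵀ T₁₃ᵀ T₂₃ᵀ T₃₃ᵀ := by
  ext (i | i | i) (j | j | j) <;> rfl

namespace Data

variable {n m l : ℕ}

/-- The three enclosures of an eigenvalue, one for each position of `[γ̲, γ̄]` relative to `1`. -/
def Enclosed (P : Data n m l) (z : ℂ) : Prop :=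
  (P.gammaMax ≤ 1 → P.etaMin₁ ≤ z.re ∧ z.re ≤ P.etaMax₁ ∧ |z.im| ≤ P.rho₁) ∧
  (1 ≤ P.gammaMin → P.etaMin₂ ≤ z.re ∧ z.re ≤ P.etaMax₂ ∧ |z.im| ≤ P.rho₂) ∧
  (P.gammaMin < 1 → 1 < P.gammaMax →
    P.etaMin₃ ≤ z.re ∧ z.re ≤ P.etaMax₃ ∧ |z.im| ≤ P.rho₃)

/-- The enclosures depend on the data only through the extreme eigenvalues. -/
theorem Enclosed.of_eq {P Q : Data n m l} {z : ℂ} (h : Q.Enclosed z)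
    (mu : P.muMin = Q.muMin ∧ P.muMax = Q.muMax) (nu : P.nuMin = Q.nuMin ∧ P.nuMax = Q.nuMax)
    (omega : P.omegaMax = Q.omegaMax) (tau : P.tauMin = Q.tauMin ∧ P.tauMax = Q.tauMax)
    (varphi : P.varphiMin = Q.varphiMin ∧ P.varphiMax = Q.varphiMax)
    (phi : P.phiMin = Q.phiMin ∧ P.phiMax = Q.phiMax)
    (kappa : P.kappaMin = Q.kappaMin ∧ P.kappaMax = Q.kappaMax)
    (gamma : P.gammaMin = Q.gammaMin ∧ P.gammaMax = Q.gammaMax)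
    (h₁ : lamMax ((1 - P.YA * P.A) * (1 - P.ZA * P.A) * P.MA⁻¹ * P.A) =
      lamMax ((1 - Q.YA * Q.A) * (1 - Q.ZA * Q.A) * Q.MA⁻¹ * Q.A))
    (h₃ : lamMax (P.MA⁻¹ * P.A * (1 - P.MA⁻¹ * P.A)) =
      lamMax (Q.MA⁻¹ * Q.A * (1 - Q.MA⁻¹ * Q.A))) : P.Enclosed z := by
  unfold Enclosed etaMin₁ etaMax₁ rho₁ etaMin₂ etaMax₂ rho₂ etaMin₃ etaMax₃ rho₃ xiHat xiOne
    hMin hMax at h ⊢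
  rw [mu.1, mu.2, nu.1, nu.2, omega, tau.1, tau.2, varphi.1, varphi.2, phi.1, phi.2, kappa.1,
    kappa.2, gamma.1, gamma.2, h₁, h₃]
  exact h

/-- The data with `Y_A` and `Z_A` exchanged; its preconditioner is the transpose. -/
def swap (P : Data n m l) : Data n m l := { P with YA := P.ZA, ZA := P.YA }

end Data

namespace Normalized

variable {n m l : ℕ} {P : Data n m l} {a : Fin n → ℝ} {s : ℝ}

theorem swap (N : Normalized P a s) : Normalized P.swap a s :=
  ⟨N.m_pos, N.l_pos, N.n_pos, N.MA_eq, N.Sh_eq, N.MSh_eq, N.A_eq, N.a_pos, N.D_psd, N.WS_eq,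
    N.s_eq⟩

/-- `M` and `K` for the exchanged data are the transposes of `M` and `K`. -/
theorem det_swap (N : Normalized P a s) {η ζ : ℝ} (hη : P.YA = η • 1) (hζ : P.ZA = ζ • 1)
    (z : ℂ) : (z • cplx P.swap.M - cplx P.swap.K).det = (z • cplx P.M - cplx P.K).det := by
  have hD : P.Dᵀ = P.D := (conjTranspose_eq_transpose_of_trivial P.D).symm.trans N.D_psd.1
  have hM : P.swap.M = P.Mᵀ := by
    simp only [Data.M, Data.swap, transpose_mul, block3_transpose, N.MA_eq, N.Sh_eq, N.MSh_eq,
      N.WS_eq, hη, hζ, transpose_one, transpose_zero, transpose_neg, transpose_smul,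
      transpose_transpose, Matrix.mul_assoc]
  have hK : P.swap.K = P.Kᵀ := by
    simp only [Data.K, Data.swap, block3_transpose, N.A_eq, hD, transpose_zero,
      transpose_transpose, diagonal_transpose]
  rw [hM, hK, ← det_transpose (z • cplx P.M - cplx P.K)]
  rfl

/-- The eigenvalue equations in terms of `x, y, z`, the image of the eigenvector under the upper
triangular factor of the preconditioner. -/
theorem exists_equations (N : Normalized P a s) {η ζ : ℝ} (hη : P.YA = η • 1) (hζ : P.ZA = ζ • 1)
    {lam : ℂ} (hdet : (lam • cplx P.M - cplx P.K).det = 0) :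
    ∃ (x : Fin n → ℂ) (y : Fin m → ℂ) (z : Fin l → ℂ), (x ≠ 0 ∨ y ≠ 0 ∨ z ≠ 0) ∧
      (∀ i, a i * x i + (1 - ζ * a i) *
        (((cplx P.B)ᵀ *ᵥ y) i + ((cplx P.B)ᵀ *ᵥ (s : ℂ) • (cplx P.C)ᵀ *ᵥ z) i) = lam * x i) ∧
      (lam • y = cplx P.B *ᵥ (fun i => -((1 - η * a i) * x i) + (η + ζ - η * ζ * a i) *
        (((cplx P.B)ᵀ *ᵥ y) i + ((cplx P.B)ᵀ *ᵥ (s : ℂ) • (cplx P.C)ᵀ *ᵥ z) i))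
          - (cplx P.C)ᵀ *ᵥ z) ∧
      (lam • z = cplx P.C *ᵥ (y + (s : ℂ) • (cplx P.C)ᵀ *ᵥ z) + cplx P.D *ᵥ z
        - (s : ℂ) • cplx P.C *ᵥ (lam • y)) := by
  obtain ⟨v, hv, h⟩ := exists_mulVec_eq_zero_iff.mpr hdet
  obtain ⟨v₁, v₂, v₃, rfl⟩ : ∃ v₁ v₂ v₃, v = Sum.elim v₁ (Sum.elim v₂ v₃) :=
    ⟨fun i => v (.inl i), fun j => v (.inr (.inl j)), fun k => v (.inr (.inr k)), by
      ext (i | j | k) <;> rfl⟩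
  have cT : ∀ {p q : ℕ} (X : Matrix (Fin p) (Fin q) ℝ), cplx Xᵀ = (cplx X)ᵀ := fun X => rfl
  have c1 : ∀ {p : ℕ}, cplx (1 : Matrix (Fin p) (Fin p) ℝ) = 1 := by
    intro p
    ext i j
    simp [Matrix.one_apply, apply_ite Complex.ofReal]
  have c0 : ∀ {p q : ℕ}, cplx (0 : Matrix (Fin p) (Fin q) ℝ) = 0 := by
    intro p q
    ext i j
    simp
  have cn : ∀ {p q : ℕ} (X : Matrix (Fin p) (Fin q) ℝ), cplx (-X) = -cplx X := by
    intro p q X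
    ext i j
    simp
  have cs : ∀ {p q : ℕ} (r : ℝ) (X : Matrix (Fin p) (Fin q) ℝ),
      cplx (r • X) = (r : ℂ) • cplx X := by
    intro p q r X
    ext i j
    simp
  have cd : cplx (diagonal a) = diagonal fun i => (a i : ℂ) := by
    ext i j
    simp [Matrix.diagonal_apply, apply_ite Complex.ofReal]
  rw [sub_mulVec, smul_mulVec, sub_eq_zero] at h
  rw [Data.M, Data.K, cplx_mul, cplx_mul, ← mulVec_mulVec, ← mulVec_mulVec,
    cplx_block3_mulVec, cplx_block3_mulVec, cplx_block3_mulVec, cplx_block3_mulVec] at h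
  simp only [N.MA_eq, N.Sh_eq, N.MSh_eq, N.WS_eq, N.A_eq, hη, hζ, cT, c1, c0, cn, cs, cd,
    Matrix.mul_smul, Matrix.smul_mul, Matrix.one_mul, Matrix.mul_one, one_mulVec, zero_mulVec,
    neg_mulVec, smul_mulVec, add_zero, zero_add] at h
  set x : Fin n → ℂ := v₁ + (ζ : ℂ) • (cplx P.B)ᵀ *ᵥ v₂ with hx
  set y : Fin m → ℂ := v₂ + -((s : ℂ) • (cplx P.C)ᵀ *ᵥ v₃) with hy
  have e1 := fun i => congrFun h (.inl i)
  have e2 := fun j => congrFun h (.inr (.inl j))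
  have e3 := fun k => congrFun h (.inr (.inr k))
  simp only [Pi.smul_apply, Sum.elim_inl, Sum.elim_inr, Pi.add_apply, Pi.neg_apply,
    smul_eq_mul, mulVec_diagonal] at e1 e2 e3
  have hyp : y + (s : ℂ) • (cplx P.C)ᵀ *ᵥ v₃ = v₂ := by
    rw [hy]
    abel
  have hb : ∀ i, ((cplx P.B)ᵀ *ᵥ y) i + ((cplx P.B)ᵀ *ᵥ (s : ℂ) • (cplx P.C)ᵀ *ᵥ v₃) i =
      ((cplx P.B)ᵀ *ᵥ v₂) i := fun i => by
    rw [← Pi.add_apply, ← mulVec_add, hyp]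
  have hxi : ∀ i, v₁ i = x i - ζ * ((cplx P.B)ᵀ *ᵥ v₂) i := fun i => by
    rw [hx]
    simp
  have E1 : ∀ i, a i * x i + (1 - ζ * a i) * ((cplx P.B)ᵀ *ᵥ v₂) i = lam * x i := fun i => by
    rw [e1 i, hxi]
    ring
  refine ⟨x, y, v₃, ?_, fun i => by rw [hb]; exact E1 i, ?_, ?_⟩
  · by_contra! h0
    obtain ⟨hx0, hy0, hz0⟩ := h0
    have h2 : v₂ = 0 := by rw [← hyp, hy0, hz0, mulVec_zero, smul_zero, add_zero]
    have h1 : v₁ = 0 := by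
      ext i
      rw [hxi, hx0, h2, mulVec_zero]
      simp
    refine hv ?_
    rw [h1, h2, hz0]
    ext (i | j | k) <;> rfl
  · simp only [hb]
    have hw : (fun i => -((1 - (η : ℂ) * a i) * x i) + (η + ζ - η * ζ * a i) *
        ((cplx P.B)ᵀ *ᵥ v₂) i) = (η * lam) • x - v₁ := by
      ext i
      simp only [Pi.sub_apply, Pi.smul_apply, smul_eq_mul]
      rw [hxi]
      linear_combination (η : ℂ) * E1 i
    rw [hw, mulVec_sub, mulVec_smul]
    ext j
    have := e2 j
    simp only [Pi.sub_apply, Pi.smul_apply, smul_eq_mul] at this ⊢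
    linear_combination -this
  · rw [hyp, mulVec_smul]
    ext k
    have := e3 k
    simp only [Pi.sub_apply, Pi.smul_apply, Pi.add_apply, smul_eq_mul, mulVec_neg,
      Pi.neg_apply] at this ⊢
    linear_combination this

end Normalized

/-! ### Enclosures for the normalized data -/

theorem sum_normSq_pos {n m l : ℕ} {x : Fin n → ℂ} {y : Fin m → ℂ} {z : Fin l → ℂ}
    (h : x ≠ 0 ∨ y ≠ 0 ∨ z ≠ 0) :
    0 < ∑ i, Complex.normSq (x i) + ∑ j, Complex.normSq (y j) + ∑ k, Complex.normSq (z k) := by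
  have key : ∀ {p : ℕ} {v : Fin p → ℂ}, v ≠ 0 → 0 < ∑ i, Complex.normSq (v i) := by
    intro p v hv
    obtain ⟨i, hi⟩ := Function.ne_iff.mp hv
    exact Finset.sum_pos' (fun _ _ => Complex.normSq_nonneg _)
      ⟨i, Finset.mem_univ i, Complex.normSq_pos.mpr hi⟩
  have hx := sum_normSq_nonneg Finset.univ x
  have hy := sum_normSq_nonneg Finset.univ y
  have hz := sum_normSq_nonneg Finset.univ z
  rcases h with h | h | h <;> linarith [key h]

namespace Normalized

variable {n m l : ℕ} {P : Data n m l} {a : Fin n → ℝ} {s : ℝ}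

theorem gamma_mat (N : Normalized P a s) {η ζ : ℝ} (hη : P.YA = η • 1) (hζ : P.ZA = ζ • 1) :
    P.YA * P.A + P.ZA * P.A - P.YA * P.A * P.ZA * P.A =
      diagonal fun i => a i * (η + ζ - η * ζ * a i) := by
  rw [hη, hζ, N.A_eq]
  simp only [Matrix.smul_mul, Matrix.mul_smul, Matrix.one_mul, Matrix.mul_one, diagonal_mul_diagonal]
  ext i j
  by_cases h : i = j
  · subst h
    simp
    ring
  · simp [h]

theorem mem_gamma (N : Normalized P a s) {η ζ : ℝ} (hη : P.YA = η • 1) (hζ : P.ZA = ζ • 1)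
    (i : Fin n) : P.gammaMin ≤ a i * (η + ζ - η * ζ * a i) ∧
      a i * (η + ζ - η * ζ * a i) ≤ P.gammaMax := by
  rw [Data.gammaMin, Data.gammaMax, N.gamma_mat hη hζ]
  have h := mem_eigs_diagonal (fun i => a i * (η + ζ - η * ζ * a i)) i
  exact ⟨lamMin_le h, le_lamMax h⟩

theorem exists_gammaMin_eq (N : Normalized P a s) {η ζ : ℝ} (hη : P.YA = η • 1)
    (hζ : P.ZA = ζ • 1) : ∃ i, P.gammaMin = a i * (η + ζ - η * ζ * a i) := by
  have := N.nonempty_n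
  rw [Data.gammaMin, N.gamma_mat hη hζ]
  have h := lamMin_mem (isHermitian_diagonal fun i => a i * (η + ζ - η * ζ * a i))
  rw [eigs_diagonal] at h
  obtain ⟨i, hi⟩ := h
  exact ⟨i, hi.symm⟩

theorem exists_gammaMax_eq (N : Normalized P a s) {η ζ : ℝ} (hη : P.YA = η • 1)
    (hζ : P.ZA = ζ • 1) : ∃ i, P.gammaMax = a i * (η + ζ - η * ζ * a i) := by
  have := N.nonempty_n
  rw [Data.gammaMax, N.gamma_mat hη hζ]
  have h := lamMax_mem (isHermitian_diagonal fun i => a i * (η + ζ - η * ζ * a i))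
  rw [eigs_diagonal] at h
  obtain ⟨i, hi⟩ := h
  exact ⟨i, hi.symm⟩

theorem le_skew₁ (N : Normalized P a s) {η ζ : ℝ} (hη : P.YA = η • 1) (hζ : P.ZA = ζ • 1)
    (i : Fin n) : a i * ((1 - η * a i) * (1 - ζ * a i)) ≤
      lamMax ((1 - P.YA * P.A) * (1 - P.ZA * P.A) * P.MA⁻¹ * P.A) := by
  have h : (1 - P.YA * P.A) * (1 - P.ZA * P.A) * P.MA⁻¹ * P.A =
      diagonal fun i => a i * ((1 - η * a i) * (1 - ζ * a i)) := by
    have h1 : ∀ r : ℝ, (1 : Matrix (Fin n) (Fin n) ℝ) - r • diagonal a =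
        diagonal fun i => 1 - r * a i := fun r => by
      ext i j
      by_cases hij : i = j
      · subst hij
        simp
      · simp [hij]
    rw [hη, hζ, N.A_eq, N.MA_eq, inv_one, Matrix.mul_one, Matrix.smul_mul, Matrix.smul_mul,
      Matrix.one_mul, h1, h1, diagonal_mul_diagonal, diagonal_mul_diagonal]
    congr 1
    ext i
    ring
  rw [h]
  exact le_lamMax (mem_eigs_diagonal (fun i => a i * ((1 - η * a i) * (1 - ζ * a i))) i)

theorem le_skew₃ (N : Normalized P a s) (i : Fin n) :
    a i * (1 - a i) ≤ lamMax (P.MA⁻¹ * P.A * (1 - P.MA⁻¹ * P.A)) := by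
  have h : P.MA⁻¹ * P.A * (1 - P.MA⁻¹ * P.A) = diagonal fun i => a i * (1 - a i) := by
    rw [N.mu_mat, ← diagonal_one, diagonal_sub, diagonal_mul_diagonal]
  rw [h]
  exact le_lamMax (mem_eigs_diagonal (fun i => a i * (1 - a i)) i)

/-- `Y_A = Z_A = 0`: here `γ = 0`. -/
theorem enclosed_of_zero (N : Normalized P a s) (hη : P.YA = (0 : ℝ) • 1)
    (hζ : P.ZA = (0 : ℝ) • 1) (hnu : P.nuMax ≤ 2) {lam : ℂ}
    (hdet : (lam • cplx P.M - cplx P.K).det = 0) : P.Enclosed lam := by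
  obtain ⟨x, y, z, hne, h1, h2, h3⟩ := N.exists_equations hη hζ hdet
  obtain ⟨i, hi⟩ := N.exists_gammaMin_eq hη hζ
  obtain ⟨j, hj⟩ := N.exists_gammaMax_eq hη hζ
  have hγ₁ : P.gammaMin = 0 := by rw [hi]; ring
  have hγ₂ : P.gammaMax = 0 := by rw [hj]; ring
  refine ⟨fun _ => ?_, fun h => ?_, fun _ h => ?_⟩
  · have hred : ReducedEigen a (fun _ => 1) (fun _ => 0) Finset.univ s P.B P.C P.D lam x y z :=
      ⟨fun i => by simpa using h1 i, by simpa using h2, h3⟩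
    exact N.bounds₁ hred (sum_normSq_pos hne) (fun i => by simp) hnu
      (fun i => by simpa using N.mem_gamma hη hζ i) hγ₁.ge (by rw [hγ₂]; exact zero_le_one)
      (fun i => by simpa using N.le_skew₁ hη hζ i)
  · rw [hγ₁] at h
    exact absurd h (by norm_num)
  · rw [hγ₂] at h
    exact absurd h (by norm_num)

/-- `Y_A = Z_A = M_A⁻¹`: here `γ = 1 - (1 - a)²`. -/
theorem enclosed_of_one (N : Normalized P a s) (hη : P.YA = (1 : ℝ) • 1)
    (hζ : P.ZA = (1 : ℝ) • 1) (hmu : P.muMax ≤ 2) (hnu : P.nuMax ≤ 2)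
    (hmunu : P.muMax * P.nuMax ≤ 2) {lam : ℂ}
    (hdet : (lam • cplx P.M - cplx P.K).det = 0) : P.Enclosed lam := by
  obtain ⟨x, y, z, hne, h1, h2, h3⟩ := N.exists_equations hη hζ hdet
  obtain ⟨i, hi⟩ := N.exists_gammaMin_eq hη hζ
  obtain ⟨j, hj⟩ := N.exists_gammaMax_eq hη hζ
  have hγ₀ : 0 ≤ P.gammaMin := by
    rw [hi]
    exact mul_nonneg (N.a_pos i).le (by linarith [N.le_muMax i])
  have hγ₂ : P.gammaMax ≤ 1 := by
    rw [hj]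
    nlinarith [sq_nonneg (1 - a j)]
  refine ⟨fun _ => ?_, fun h => ?_, fun _ h => absurd h hγ₂.not_gt⟩
  · have hred : ReducedEigen a (fun i => 1 - a i) (fun i => 2 - a i) Finset.univ s P.B P.C P.D
        lam x y z := by
      refine ⟨fun i => by simpa using h1 i, ?_, h3⟩
      rw [h2]
      congr 2
      ext i
      simp only [Finset.mem_univ, if_true]
      push_cast
      ring
    refine N.bounds₁ hred (sum_normSq_pos hne) (fun i => by ring) hnu
      (fun i => ?_) hγ₀ hγ₂ (fun i => ?_)
    · have := N.mem_gamma hη hζ i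
      rwa [show (1 : ℝ) + 1 - 1 * 1 * a i = 2 - a i by ring] at this
    · have := N.le_skew₁ hη hζ i
      rwa [show (1 - 1 * a i) * (1 - 1 * a i) = (1 - a i) ^ 2 by ring] at this
  -- `1 ≤ γ` forces `A = M_A`, and the block coupling `x` and `y` vanishes.
  · have ha : ∀ i, a i = 1 := fun i => by
      have := h.trans (N.mem_gamma hη hζ i).1
      nlinarith [sq_nonneg (1 - a i)]
    have hred : ReducedEigen a (fun _ => 0) (fun _ => 1) ∅ s P.B P.C P.D lam x y z := by
      refine ⟨fun i => ?_, ?_, h3⟩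
      · have := h1 i
        rw [ha] at this ⊢
        simpa using this
      · rw [h2]
        congr 2
        ext i
        rw [ha]
        simp
    exact N.bounds₂ hred (sum_normSq_pos hne) (fun _ => rfl) (fun i => by simp [ha]) hmunu

/-- `Y_A = M_A⁻¹`, `Z_A = 0`: here `γ = a`. The vector `x` is multiplied by `|1 - a|^{1/2}`. This
annihilates an eigenvector with `y = z = 0` supported on the indices with `a = 1`, but then the
eigenvalue is `1`, an eigenvalue of `M_A⁻¹A`. -/
theorem enclosed_of_one_zero (N : Normalized P a s) (hη : P.YA = (1 : ℝ) • 1)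
    (hζ : P.ZA = (0 : ℝ) • 1) (hnu : P.nuMax ≤ 2)
    (hmunu : P.muMax * P.nuMax ≤ 2) {lam : ℂ}
    (hdet : (lam • cplx P.M - cplx P.K).det = 0) : P.Enclosed lam := by
  obtain ⟨x, y, z, hne, h1, h2, h3⟩ := N.exists_equations hη hζ hdet
  have hmat : P.YA * P.A + P.ZA * P.A - P.YA * P.A * P.ZA * P.A = P.MA⁻¹ * P.A := by
    rw [hη, hζ, N.MA_eq, inv_one]
    simp
  have hγ₁ : P.gammaMin = P.muMin := by rw [Data.gammaMin, Data.muMin, hmat]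
  have hγ₂ : P.gammaMax = P.muMax := by rw [Data.gammaMax, Data.muMax, hmat]
  set e : Fin n → ℝ := fun i => √|1 - a i| with he
  have he2 : ∀ i, e i ^ 2 = |1 - a i| := fun i => Real.sq_sqrt (abs_nonneg _)
  have hred : ∀ I : Finset (Fin n), (∀ i, (if i ∈ I then 1 else -1) * |1 - a i| = 1 - a i) →
      ReducedEigen a e (fun _ => 1) I s P.B P.C P.D lam (fun i => e i * x i) y z := fun I hI => by
    refine ⟨fun i => ?_, ?_, h3⟩
    · have := h1 i
      push_cast at this
      linear_combination (e i : ℂ) * this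
    · rw [h2]
      congr 2
      ext i
      have hc : (if i ∈ I then (1 : ℂ) else -1) * ((e i : ℂ) * e i) = 1 - a i := by
        have h4 := hI i
        rw [← he2, sq] at h4
        have h5 := congrArg Complex.ofReal h4
        push_cast [apply_ite Complex.ofReal] at h5
        exact h5
      push_cast
      linear_combination x i * hc
  by_cases hz : (fun i => (e i : ℂ) * x i) ≠ 0 ∨ y ≠ 0 ∨ z ≠ 0
  · have hN := sum_normSq_pos hz
    refine ⟨fun h => ?_, fun h => ?_, fun h h' => ?_⟩
    · have ha : ∀ i, a i ≤ 1 := fun i => (N.le_muMax i).trans (hγ₂ ▸ h)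
      refine N.bounds₁ (hred Finset.univ fun i => ?_) hN (fun i => ?_) hnu (fun i => ?_)
        (hγ₁ ▸ N.muMin_pos.le) h (fun i => ?_)
      · simpa using ha i
      · rw [he2, abs_of_nonneg (sub_nonneg.mpr (ha i))]
        ring
      · rw [hγ₁, hγ₂, mul_one]
        exact ⟨N.muMin_le i, N.le_muMax i⟩
      · rw [he2, abs_of_nonneg (sub_nonneg.mpr (ha i))]
        simpa using N.le_skew₁ hη hζ i
    · have ha : ∀ i, 1 ≤ a i := fun i => (hγ₁ ▸ h).trans (N.muMin_le i)
      refine N.bounds₂ (hred ∅ fun i => ?_) hN (fun _ => rfl) (fun i => ?_) hmunu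
      · rw [abs_of_nonpos (sub_nonpos.mpr (ha i))]
        simp
      · rw [he2, abs_of_nonpos (sub_nonpos.mpr (ha i))]
        ring
    · rw [hγ₁] at h
      rw [hγ₂] at h'
      obtain ⟨i₀, hi₀⟩ := N.exists_gammaMin_eq hη hζ
      have hi₁ : a i₀ ≤ 1 := by
        rw [hγ₁] at hi₀
        linarith
      refine N.bounds₃ (hred (Finset.univ.filter fun i => a i ≤ 1) fun i => ?_) hN
        (fun i => by simp) (fun _ => rfl) he2 hmunu h.le h'.le hγ₁ ?_ N.le_skew₃
      · by_cases hi : a i ≤ 1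
        · simp [hi]
        · simp [hi, abs_of_nonpos (sub_nonpos.mpr (not_le.mp hi).le)]
      · exact (mul_nonneg (N.a_pos i₀).le (sub_nonneg.mpr hi₁)).trans (N.le_skew₃ i₀)
  · push Not at hz
    obtain ⟨hx0, hy0, hz0⟩ := hz
    have hx : x ≠ 0 := by
      rcases hne with h | h | h
      · exact h
      · exact absurd hy0 h
      · exact absurd hz0 h
    obtain ⟨i, hi⟩ := Function.ne_iff.mp hx
    have hi' : x i ≠ 0 := hi
    have hei : (e i : ℂ) = 0 := (mul_eq_zero.mp (congrFun hx0 i)).resolve_right hi'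
    have hai : a i = 1 := by
      have h4 := he2 i
      rw [Complex.ofReal_eq_zero.mp hei] at h4
      have h5 : |1 - a i| = 0 := by rw [← h4]; norm_num
      linarith [abs_eq_zero.mp h5]
    have hlam : lam = 1 := by
      have h4 := h1 i
      rw [hy0, hz0, hai] at h4
      simp only [mulVec_zero, smul_zero, Pi.zero_apply, add_zero, mul_zero, Complex.ofReal_one]
        at h4
      exact (mul_right_cancel₀ hi' h4).symm
    have hmin : P.muMin ≤ 1 := hai ▸ N.muMin_le i
    have hmax : 1 ≤ P.muMax := hai ▸ N.le_muMax i
    have hγ : P.gammaMin ≤ 1 := hγ₁.trans_le hmin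
    rw [hlam]
    simp only [Data.Enclosed, Complex.one_re, Complex.one_im, abs_zero]
    exact ⟨fun _ => ⟨(N.etaMin₁_le hγ).trans hmin, hmax.trans (N.le_etaMax₁ hγ),
        Real.sqrt_nonneg _⟩,
      fun _ => ⟨(N.etaMin₂_le hmax).trans hmin, hmax.trans (N.le_etaMax₂ hmax),
        Real.sqrt_nonneg _⟩,
      fun _ _ => ⟨(N.etaMin₃_le hγ).trans hmin, hmax.trans (N.le_etaMax₃ hγ hmax),
        Real.sqrt_nonneg _⟩⟩

theorem enclosed (N : Normalized P a s) (hη : P.YA = 0 ∨ P.YA = 1) (hζ : P.ZA = 0 ∨ P.ZA = 1)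
    (hmu : P.muMax ≤ 2) (hnu : P.nuMax ≤ 2) (hmunu : P.muMax * P.nuMax ≤ 2) {lam : ℂ}
    (hdet : (lam • cplx P.M - cplx P.K).det = 0) : P.Enclosed lam := by
  replace hη : P.YA = (0 : ℝ) • 1 ∨ P.YA = (1 : ℝ) • 1 := by simpa using hη
  replace hζ : P.ZA = (0 : ℝ) • 1 ∨ P.ZA = (1 : ℝ) • 1 := by simpa using hζ
  rcases hη with hη | hη <;> rcases hζ with hζ | hζ
  · exact N.enclosed_of_zero hη hζ hnu hdet
  · rw [← N.det_swap hη hζ] at hdet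
    refine (N.swap.enclosed_of_one_zero hζ hη hnu hmunu hdet).of_eq ⟨rfl, rfl⟩ ⟨rfl, rfl⟩ rfl
      ⟨rfl, rfl⟩ ⟨rfl, rfl⟩ ⟨rfl, rfl⟩ ⟨rfl, rfl⟩ ?_ ?_ rfl
    · simp [Data.gammaMin, Data.gammaMax, Data.swap, hη, hζ]
    · simp [Data.swap, hη, hζ]
  · exact N.enclosed_of_one_zero hη hζ hnu hmunu hdet
  · exact N.enclosed_of_one hη hζ hmu hnu hmunu hdet

end Normalized

/-! ### Change of coordinates -/

theorem exists_orthogonal_diagonal {k : ℕ} {X : Matrix (Fin k) (Fin k) ℝ} (hX : X.PosDef) :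
    ∃ (U : Matrix (Fin k) (Fin k) ℝ) (a : Fin k → ℝ), U * Uᵀ = 1 ∧ Uᵀ * U = 1 ∧
      Uᵀ * X * U = diagonal a ∧ ∀ i, 0 < a i := by
  obtain ⟨U, hU⟩ : ∃ U : Matrix (Fin k) (Fin k) ℝ,
    U = (hX.1.eigenvectorUnitary : Matrix (Fin k) (Fin k) ℝ) := ⟨_, rfl⟩
  have hUU : Uᵀ * U = 1 := by
    have := Unitary.coe_star_mul_self hX.1.eigenvectorUnitary
    rwa [star_eq_conjTranspose, conjTranspose_eq_transpose_of_trivial, ← hU] at this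
  have h : X = U * diagonal hX.1.eigenvalues * Uᵀ := by
    have := hX.1.spectral_theorem
    rw [Unitary.conjStarAlgAut_apply, star_eq_conjTranspose,
      conjTranspose_eq_transpose_of_trivial, ← hU] at this
    exact this
  refine ⟨U, hX.1.eigenvalues, mul_eq_one_comm.mp hUU, hUU, ?_, hX.eigenvalues_pos⟩
  calc Uᵀ * X * U = Uᵀ * (U * diagonal hX.1.eigenvalues * Uᵀ) * U :=
        congrArg (fun Y => Uᵀ * Y * U) h
    _ = (Uᵀ * U) * diagonal hX.1.eigenvalues * (Uᵀ * U) := by simp only [Matrix.mul_assoc]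
    _ = diagonal hX.1.eigenvalues := by rw [hUU, Matrix.one_mul, Matrix.mul_one]

theorem exists_congr_one {k : ℕ} {H : Matrix (Fin k) (Fin k) ℝ} (hH : H.PosDef) :
    ∃ R R' : Matrix (Fin k) (Fin k) ℝ, R * R' = 1 ∧ Rᵀ * H * R = 1 := by
  obtain ⟨U, a, hU, _, hd, ha⟩ := exists_orthogonal_diagonal hH
  have hs : ∀ i, √(a i) ≠ 0 := fun i => (Real.sqrt_pos.mpr (ha i)).ne'
  refine ⟨U * diagonal fun i => (√(a i))⁻¹, (diagonal fun i => √(a i)) * Uᵀ, ?_, ?_⟩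
  · rw [Matrix.mul_assoc, ← Matrix.mul_assoc (diagonal _), diagonal_mul_diagonal]
    simp only [inv_mul_cancel₀ (hs _), diagonal_one, Matrix.one_mul, hU]
  · rw [transpose_mul, diagonal_transpose]
    calc (diagonal fun i => (√(a i))⁻¹) * Uᵀ * H * (U * diagonal fun i => (√(a i))⁻¹) =
          (diagonal fun i => (√(a i))⁻¹) * (Uᵀ * H * U) * diagonal fun i => (√(a i))⁻¹ := by
          simp only [Matrix.mul_assoc]
      _ = 1 := by
          rw [hd, diagonal_mul_diagonal, diagonal_mul_diagonal, ← diagonal_one]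
          congr 1
          ext i
          rw [mul_right_comm, ← mul_inv, Real.mul_self_sqrt (ha i).le, inv_mul_cancel₀ (ha i).ne']

/-- Simultaneous diagonalization of two positive definite matrices by congruence. -/
theorem exists_congr_diagonal {k : ℕ} {H A : Matrix (Fin k) (Fin k) ℝ} (hH : H.PosDef)
    (hA : A.PosDef) : ∃ (R R' : Matrix (Fin k) (Fin k) ℝ) (a : Fin k → ℝ), R * R' = 1 ∧
      Rᵀ * H * R = 1 ∧ Rᵀ * A * R = diagonal a ∧ ∀ i, 0 < a i := by
  obtain ⟨R, R', hR, h1⟩ := exists_congr_one hH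
  have hAR : (Rᵀ * A * R).PosDef := by
    have hinj : Function.Injective R.mulVec := fun u v huv => by
      have h2 : R' * R = 1 := mul_eq_one_comm.mp hR
      rw [← one_mulVec u, ← one_mulVec v, ← h2, ← mulVec_mulVec, ← mulVec_mulVec]
      exact congrArg _ huv
    have := hA.conjTranspose_mul_mul_same hinj
    rwa [conjTranspose_eq_transpose_of_trivial] at this
  obtain ⟨U, a, hU, hU', hd, ha⟩ := exists_orthogonal_diagonal hAR
  have hc : ∀ X, (R * U)ᵀ * X * (R * U) = Uᵀ * (Rᵀ * X * R) * U := fun X => by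
    rw [transpose_mul]
    simp only [Matrix.mul_assoc]
  refine ⟨R * U, Uᵀ * R', a, ?_, ?_, ?_, ha⟩
  · rw [Matrix.mul_assoc, ← Matrix.mul_assoc U, hU, Matrix.one_mul, hR]
  · rw [hc, h1, Matrix.mul_one, hU']
  · rw [hc, hd]

theorem inv_congr {k : ℕ} {R R' : Matrix (Fin k) (Fin k) ℝ} (h : R * R' = 1)
    (H : Matrix (Fin k) (Fin k) ℝ) : (Rᵀ * H * R)⁻¹ = R' * H⁻¹ * R'ᵀ := by
  have h1 : R⁻¹ = R' := inv_eq_right_inv h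
  rw [Matrix.mul_inv_rev, Matrix.mul_inv_rev, ← transpose_nonsing_inv, h1, Matrix.mul_assoc]

theorem mul_mul_cancel {k p : ℕ} {R R' : Matrix (Fin k) (Fin k) ℝ} (h : R * R' = 1)
    (X : Matrix (Fin k) (Fin p) ℝ) : R * (R' * X) = X := by
  rw [← Matrix.mul_assoc, h, Matrix.one_mul]

theorem transpose_mul_mul_cancel {k p : ℕ} {R R' : Matrix (Fin k) (Fin k) ℝ} (h : R * R' = 1)
    (X : Matrix (Fin k) (Fin p) ℝ) : R'ᵀ * (Rᵀ * X) = X := by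
  rw [← Matrix.mul_assoc, ← transpose_mul, h, transpose_one, Matrix.one_mul]

namespace Data

variable {n m l : ℕ}

/-- The data in new coordinates: `R`, `T`, `V` are the coordinate changes of the three blocks and
`R'`, `T'` the inverses of `R`, `T`. The matrices `W_S`, `Y_A`, `Z_A` transform like inverses. -/
def congr (P : Data n m l) (R R' : Matrix (Fin n) (Fin n) ℝ) (T T' : Matrix (Fin m) (Fin m) ℝ)
    (V : Matrix (Fin l) (Fin l) ℝ) : Data n m l where
  A := Rᵀ * P.A * R
  B := Tᵀ * P.B * R
  C := Vᵀ * P.C * T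
  D := Vᵀ * P.D * V
  MA := Rᵀ * P.MA * R
  Sh := Tᵀ * P.Sh * T
  MSh := Vᵀ * P.MSh * V
  WS := T' * P.WS * T'ᵀ
  YA := R' * P.YA * R'ᵀ
  ZA := R' * P.ZA * R'ᵀ

section Congr

variable (P : Data n m l) {R R' : Matrix (Fin n) (Fin n) ℝ} {T T' : Matrix (Fin m) (Fin m) ℝ}
  {V V' : Matrix (Fin l) (Fin l) ℝ}

theorem M_congr (hR : R * R' = 1) (hT : T * T' = 1) :
    (P.congr R R' T T' V).M =
      (block3 R 0 0 0 T 0 0 0 V)ᵀ * P.M * block3 R 0 0 0 T 0 0 0 V := by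
  simp only [Data.M, Data.congr, block3_mul, block3_transpose, transpose_mul, transpose_zero,
    transpose_transpose, Matrix.mul_assoc, mul_mul_cancel hR, transpose_mul_mul_cancel hR, mul_mul_cancel hT, transpose_mul_mul_cancel hT, Matrix.mul_zero, Matrix.zero_mul,
    add_zero, zero_add, Matrix.mul_one, Matrix.one_mul, Matrix.mul_add, Matrix.add_mul,
    Matrix.mul_neg, Matrix.neg_mul, neg_zero, neg_neg]

theorem K_congr :
    (P.congr R R' T T' V).K =
      (block3 R 0 0 0 T 0 0 0 V)ᵀ * P.K * block3 R 0 0 0 T 0 0 0 V := by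
  simp only [Data.K, Data.congr, block3_mul, block3_transpose, transpose_mul, transpose_zero,
    transpose_transpose, Matrix.mul_assoc, Matrix.mul_zero, Matrix.zero_mul, add_zero, zero_add]

theorem det_congr (hR : R * R' = 1) (hT : T * T' = 1) {z : ℂ}
    (hdet : (z • cplx P.M - cplx P.K).det = 0) :
    (z • cplx (P.congr R R' T T' V).M - cplx (P.congr R R' T T' V).K).det = 0 := by
  rw [P.M_congr hR hT, P.K_congr, cplx_mul, cplx_mul, cplx_mul, cplx_mul, ← Matrix.smul_mul,
    ← Matrix.mul_smul, ← Matrix.sub_mul, ← Matrix.mul_sub, det_mul, det_mul, hdet, mul_zero,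
    zero_mul]

theorem S_congr (hR : R * R' = 1) : (P.congr R R' T T' V).S = Tᵀ * P.S * T := by
  simp only [Data.S, Data.congr]
  rw [inv_congr hR]
  simp only [ transpose_mul, transpose_transpose,
    Matrix.mul_assoc, mul_mul_cancel hR, transpose_mul_mul_cancel hR]

theorem lam_eq {k : ℕ} {R R' X Y : Matrix (Fin k) (Fin k) ℝ} (h : R * R' = 1)
    (hY : Y = R' * X * R) : lamMin X = lamMin Y ∧ lamMax X = lamMax Y := by
  rw [hY, lamMin, lamMin, lamMax, lamMax, eigs_conj h]
  exact ⟨rfl, rfl⟩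

theorem mu_congr (hR : R * R' = 1) : P.muMin = (P.congr R R' T T' V).muMin ∧
    P.muMax = (P.congr R R' T T' V).muMax := by
  refine lam_eq hR ?_
  simp only [congr]
  rw [inv_congr hR]
  simp only [Matrix.mul_assoc, transpose_mul_mul_cancel hR]

theorem nu_congr (hR : R * R' = 1) (hT : T * T' = 1) :
    P.nuMin = (P.congr R R' T T' V).nuMin ∧ P.nuMax = (P.congr R R' T T' V).nuMax := by
  refine lam_eq hT ?_
  rw [P.S_congr hR]
  simp only [congr]
  rw [inv_congr hT]
  simp only [Matrix.mul_assoc, transpose_mul_mul_cancel hT]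

/-- The eigenvalues that enter the enclosures are invariant under the change of coordinates. -/
theorem enclosed_of_congr (hR : R * R' = 1) (hT : T * T' = 1) (hV : V * V' = 1) {z : ℂ}
    (h : (P.congr R R' T T' V).Enclosed z) : P.Enclosed z := by
  have hMA := inv_congr hR P.MA
  have hSh := inv_congr hT P.Sh
  have hMSh := inv_congr hV P.MSh
  simp only [Matrix.mul_assoc] at hMA hSh hMSh
  have hS := P.S_congr (R' := R') (T := T) (T' := T') (V := V) hR
  refine h.of_eq (P.mu_congr hR) (P.nu_congr hR hT) (lam_eq hV ?_).2 (lam_eq hV ?_) (lam_eq hT ?_)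
    (lam_eq hV ?_) (lam_eq hV ?_) (lam_eq hR ?_) (lam_eq hR ?_).2 (lam_eq hR ?_).2
  · simp only [congr, hSh, hMSh, Matrix.mul_assoc, transpose_mul, transpose_transpose, mul_mul_cancel hT, transpose_mul_mul_cancel hT, transpose_mul_mul_cancel hV]
  · simp only [congr, hMSh, Matrix.mul_assoc, transpose_mul_mul_cancel hV]
  · rw [hS]
    simp only [congr, Matrix.mul_assoc, transpose_mul_mul_cancel hT]
  · simp only [congr, hMSh, Matrix.mul_assoc, transpose_mul, transpose_transpose, mul_mul_cancel hT, transpose_mul_mul_cancel hT, transpose_mul_mul_cancel hV]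
  · simp only [congr, hMSh, Matrix.mul_assoc, transpose_mul, transpose_transpose, mul_mul_cancel hT, transpose_mul_mul_cancel hT, transpose_mul_mul_cancel hV,
      Matrix.mul_add, Matrix.add_mul]
  · simp only [congr, Matrix.mul_assoc, mul_mul_cancel hR, transpose_mul_mul_cancel hR, Matrix.mul_add, Matrix.add_mul, Matrix.mul_sub,
      Matrix.sub_mul]
  · simp only [congr, hMA, Matrix.mul_assoc, mul_mul_cancel hR, transpose_mul_mul_cancel hR, Matrix.mul_sub,
      Matrix.sub_mul, Matrix.one_mul, Matrix.mul_one]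
  · simp only [congr, hMA, Matrix.mul_assoc, mul_mul_cancel hR, transpose_mul_mul_cancel hR, Matrix.mul_sub,
      Matrix.sub_mul, Matrix.mul_one]

end Congr

theorem isUnit_det_M (P : Data n m l) (hMA : P.MA.PosDef) (hSh : P.Sh.PosDef)
    (hMSh : P.MSh.PosDef) : IsUnit P.M.det := by
  have h1 : P.M.det = P.MA.det * ((-P.Sh).det * P.MSh.det) := by
    simp [Data.M, block3, det_mul, det_fromBlocks_zero₁₂, det_fromBlocks_zero₂₁]
  rw [h1, det_neg]
  refine (mul_ne_zero hMA.det_pos.ne' (mul_ne_zero (mul_ne_zero ?_ hSh.det_pos.ne')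
    hMSh.det_pos.ne')).isUnit
  exact pow_ne_zero _ (by norm_num)

theorem det_eq_zero (P : Data n m l) (hM : IsUnit P.M.det) {z : ℂ}
    (hz : z ∈ eigs (cplx (P.M⁻¹ * P.K))) : (z • cplx P.M - cplx P.K).det = 0 := by
  rw [eigs_eq_spectrum, spectrum.mem_iff, isUnit_iff_isUnit_det, isUnit_iff_ne_zero, not_not] at hz
  have h1 : cplx P.M * cplx (P.M⁻¹ * P.K) = cplx P.K := by
    rw [← cplx_mul, mul_nonsing_inv_cancel_left _ _ hM]
  have h2 : z • cplx P.M - cplx P.K =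
      cplx P.M * (algebraMap ℂ _ z - cplx (P.M⁻¹ * P.K)) := by
    rw [Matrix.mul_sub, h1, Algebra.algebraMap_eq_smul_one, Matrix.mul_smul, Matrix.mul_one]
  rw [h2, det_mul, hz, mul_zero]

end Data

end InexactBlock

end

theorem theorem4p1 {n m l : ℕ} (hm : 0 < m) (hl : 0 < l)
    (P : InexactBlock.Data n m l)
    (hA : P.A.PosDef) (hB : P.B.rank = m)
    (hD : P.D.PosSemidef) (hC : ¬ P.D.PosDef → P.C.rank = l)
    (hMA : P.MA.PosDef) (hSh : P.Sh.PosDef) (hMSh : P.MSh.PosDef)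
    (hWS : P.WS = 0 ∨ P.WS = P.Sh⁻¹)
    (hYA : P.YA = 0 ∨ P.YA = P.MA⁻¹)
    (hZA : P.ZA = 0 ∨ P.ZA = P.MA⁻¹)
    (hmu : 0 < P.muMax ∧ P.muMax ≤ 2)
    (hnu : 0 < P.nuMax ∧ P.nuMax ≤ 2)
    (hmunu : 0 < P.muMax * P.nuMax ∧ P.muMax * P.nuMax < 2)
    (z : ℂ)
    (hz : z ∈ InexactBlock.eigs ((P.M⁻¹ * P.K).map (fun x : ℝ => (x : ℂ)))) :
    (P.gammaMax ≤ 1 → P.etaMin₁ ≤ z.re ∧ z.re ≤ P.etaMax₁ ∧ |z.im| ≤ P.rho₁) ∧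
    (1 ≤ P.gammaMin → P.etaMin₂ ≤ z.re ∧ z.re ≤ P.etaMax₂ ∧ |z.im| ≤ P.rho₂) ∧
    (P.gammaMin < 1 → 1 < P.gammaMax →
      P.etaMin₃ ≤ z.re ∧ z.re ≤ P.etaMax₃ ∧ |z.im| ≤ P.rho₃) := by
  have hn : 0 < n := by
    have h := P.B.rank_le_width
    omega
  obtain ⟨R, R', a, hR, h1, h2, ha⟩ := InexactBlock.exists_congr_diagonal hMA hA
  obtain ⟨T, T', hT, h3⟩ := InexactBlock.exists_congr_one hSh
  obtain ⟨V, V', hV, h4⟩ := InexactBlock.exists_congr_one hMSh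
  have hWS' : ∃ s : ℝ, (s = 0 ∨ s = 1) ∧ T' * P.WS * T'ᵀ = s • 1 := by
    rcases hWS with h | h
    · exact ⟨0, Or.inl rfl, by rw [h]; simp⟩
    · exact ⟨1, Or.inr rfl, by rw [h, ← InexactBlock.inv_congr hT, h3, inv_one, one_smul]⟩
  obtain ⟨s, hs, hWS'⟩ := hWS'
  have hYZ : ∀ Y, Y = 0 ∨ Y = P.MA⁻¹ → R' * Y * R'ᵀ = 0 ∨ R' * Y * R'ᵀ = 1 := by
    rintro Y (h | h)
    · exact Or.inl (by rw [h]; simp)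
    · exact Or.inr (by rw [h, ← InexactBlock.inv_congr hR, h1, inv_one])
  have hDpsd : (Vᵀ * P.D * V).PosSemidef := by
    have := hD.conjTranspose_mul_mul_same V
    rwa [conjTranspose_eq_transpose_of_trivial] at this
  have N : InexactBlock.Normalized (P.congr R R' T T' V) a s :=
    ⟨hm, hl, hn, h1, h3, h4, h2, ha, hDpsd, hWS', hs⟩
  refine P.enclosed_of_congr hR hT hV (N.enclosed (hYZ _ hYA) (hYZ _ hZA) ((P.mu_congr hR).2 ▸ hmu.2)
    ((P.nu_congr hR hT).2 ▸ hnu.2)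
    (by rw [← (P.mu_congr hR).2, ← (P.nu_congr hR hT).2]; exact hmunu.2.le)
    (P.det_congr hR hT (P.det_eq_zero (P.isUnit_det_M hMA hSh hMSh) hz)))
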